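/- Graphs are finite, simple and non-empty. A graph is Eulerian if all its vertex degrees are even (it need not be connected). An Eulerian orientation of $G$ is an orientation of its edges in which every vertex has equal in-degree and out-degree; $\varepsilon(G)$ is the number of Eulerian orientations and $v(G)$ the number of vertices of $G$. The $r$-ball $B_r(v)$ is the subgraph induced by the vertices at distance at most $r$ from $v$, rooted at $v$. A sequence $(G_n)$ of graphs is Benjamini–Schramm convergent if the degrees of all the $G_n$ have a common bound and, for every finite connected rooted graph $\alpha$ and every integer $r>0$, the probability that the $r$-ball at a uniform random vertex of $G_n$ is isomorphic to $\alpha$ (as a rooted graph) converges as $n\to\infty$. A graph parameter $f$ is estimable on a class $\mathcal C$ of graphs if it is bounded on $\mathcal C$ and for every $\epsilon>0$ there are positive integers $k,r$ and a real function $g$ of $k$-tuples of isomorphism classes of finite connected rooted graphs of radius at most $r$ such that, for every $G\in\mathcal C$ and independent uniform random vertices $v_1,\dots,v_k$ of $G$, $\mathbb P\big(|f(G)-g(B_r(v_1),\dots,B_r(v_k))|>\epsilon\big)\le\epsilon$. **Theorem.** Every Eulerian graph $G$ satisfies $\varepsilon(G)>0$, and the parameter $\frac{1}{v(G)}\ln\varepsilon(G)$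 is estimable for Eulerian graphs, in the following two senses. (i) If $(G_n)$ is a Benjamini–Schramm convergent sequence of Eulerian graphs, then $\lim_{n\to\infty}\frac{1}{v(G_n)}\ln\varepsilon(G_n)$ exists (as a real number). (ii) For every $\Delta$, the parameter $\frac{1}{v(G)}\ln\varepsilon(G)$ is estimable on the class of Eulerian graphs with all degrees at most $\Delta$. -/

import Mathlib

open Filter Topology

universe u

namespace EulerOr

/-- A finite simple graph with at least one vertex. -/
structure FinGraph : Type (u + 1) where
  /-- the vertices -/
  V : Type u
  [fintype : Fintype V]
  [nonempty : Nonempty V]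
  /-- the adjacency structure -/
  graph : SimpleGraph V

attribute [instance] FinGraph.fintype FinGraph.nonempty

/-- A finite connected rooted graph. -/
structure RootedGraph : Type (u + 1) where
  /-- the vertices -/
  V : Type u
  [finite : Finite V]
  /-- the adjacency structure -/
  graph : SimpleGraph V
  /-- the root -/
  root : V
  connected : graph.Connected

attribute [instance] RootedGraph.finite

/-- Isomorphism of rooted graphs: a graph isomorphism that takes the root to the root. -/
def RootedGraph.IsIso (A B : RootedGraph.{u}) : Prop :=
  ∃ e : A.graph ≃g B.graph, e A.root = B.root

/-- A rooted graph has radius at most `r` if all its vertices have distance at most `r` from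
the root. -/
def RootedGraph.RadiusLE (A : RootedGraph.{u}) (r : ℕ) : Prop :=
  ∀ w : A.V, A.graph.edist A.root w ≤ r

theorem RootedGraph.isIso_equivalence : Equivalence RootedGraph.IsIso.{u} where
  refl _ := ⟨SimpleGraph.Iso.refl, rfl⟩
  symm := by
    rintro _ _ ⟨e, he⟩
    exact ⟨e.symm, by rw [← he]; exact e.symm_apply_apply _⟩
  trans := by
    rintro _ _ _ ⟨e, he⟩ ⟨f, hf⟩
    exact ⟨e.trans f, by rw [← hf, ← he]; rfl⟩

/-- Rooted graphs of radius at most `r`, considered up to isomorphism of rooted graphs. -/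
instance RootedGraph.setoid (r : ℕ) : Setoid {A : RootedGraph.{u} // A.RadiusLE r} where
  r A B := A.1.IsIso B.1
  iseqv := ⟨fun _ => isIso_equivalence.refl _, fun h => isIso_equivalence.symm h,
    fun h h' => isIso_equivalence.trans h h'⟩

/-- The set of all possible `r`-neighbourhoods: isomorphism classes of finite connected rooted
graphs of radius at most `r`. -/
abbrev Neighbourhood (r : ℕ) : Type (u + 1) :=
  Quotient (RootedGraph.setoid.{u} r)

namespace FinGraph

/-- The number of vertices. -/
noncomputable def order (G : FinGraph.{u}) : ℕ := Nat.card G.V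

open Classical in
/-- The degree of a vertex. -/
noncomputable def deg (G : FinGraph.{u}) (v : G.V) : ℕ := G.graph.degree v

/-- Every vertex degree is even (connectedness is not required). -/
def IsEulerian (G : FinGraph.{u}) : Prop := ∀ v, Even (G.deg v)

/-- All degrees are at most `Δ`. -/
def MaxDegLE (G : FinGraph.{u}) (Δ : ℕ) : Prop := ∀ v, G.deg v ≤ Δ

/-- A digraph `D` is an orientation of `G`: its arcs lie along edges of `G`, and every edge of `G`
carries exactly one of its two possible arcs. -/
def IsOrientation (G : FinGraph.{u}) (D : Digraph G.V) : Prop :=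
  (∀ u v, D.Adj u v → G.graph.Adj u v) ∧
    ∀ u v, G.graph.Adj u v → Xor (D.Adj u v) (D.Adj v u)

/-- The out-degree equals the in-degree at every vertex. -/
def IsBalanced {V : Type u} (D : Digraph V) : Prop :=
  ∀ v, {w | D.Adj v w}.ncard = {w | D.Adj w v}.ncard

/-- The number of Eulerian (balanced) orientations. -/
noncomputable def numEulerianOrientations (G : FinGraph.{u}) : ℕ :=
  {D : Digraph G.V | G.IsOrientation D ∧ IsBalanced D}.ncard

/-- The parameter `(1 / v(G)) * ln ε(G)`. -/
noncomputable def entropy (G : FinGraph.{u}) : ℝ :=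
  1 / (G.order : ℝ) * Real.log (G.numEulerianOrientations : ℝ)

/-- The vertices at distance at most `r` from `v`. -/
def ballSet (G : FinGraph.{u}) (v : G.V) (r : ℕ) : Set G.V :=
  {w | G.graph.edist v w ≤ r}

theorem self_mem_ballSet (G : FinGraph.{u}) (v : G.V) (r : ℕ) : v ∈ G.ballSet v r := by
  simp [ballSet]

/-- Every vertex of a ball is joined to the centre by a path of length at most `r` inside it. -/
theorem exists_walk_ball (G : FinGraph.{u}) (v : G.V) (r : ℕ) (w : G.ballSet v r) :
    ∃ p : (G.graph.induce (G.ballSet v r)).Walk ⟨v, G.self_mem_ballSet v r⟩ w, p.length ≤ r := by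
  have hw : G.graph.edist v w ≤ r := w.2
  obtain ⟨p, hp⟩ := SimpleGraph.exists_walk_of_edist_ne_top
    (ne_top_of_le_ne_top (ENat.natCast_ne_top r) hw)
  have hp' : p.length ≤ r := by
    rw [← hp] at hw
    exact_mod_cast hw
  have hs : ∀ x ∈ p.support, x ∈ G.ballSet v r := by
    classical
    intro x hx
    have h1 : G.graph.edist v x ≤ ((p.takeUntil x hx).length : ℕ∞) :=
      SimpleGraph.Walk.edist_le _
    have h2 : (p.takeUntil x hx).length ≤ r := (p.length_takeUntil_le_length hx).trans hp'
    exact h1.trans (by exact_mod_cast h2)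
  refine ⟨p.induce _ hs, ?_⟩
  rw [← SimpleGraph.Walk.length_map (SimpleGraph.Embedding.induce _).toHom,
    SimpleGraph.Walk.map_induce]
  exact hp'

/-- The `r`-ball centred at `v`: the subgraph induced on the vertices at distance at most `r`
from `v`, rooted at `v`. -/
def ball (G : FinGraph.{u}) (v : G.V) (r : ℕ) : RootedGraph.{u} where
  V := G.ballSet v r
  graph := G.graph.induce (G.ballSet v r)
  root := ⟨v, G.self_mem_ballSet v r⟩
  connected := by
    have : Nonempty (G.ballSet v r) := ⟨⟨v, G.self_mem_ballSet v r⟩⟩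
    refine ⟨fun a b => ?_⟩
    obtain ⟨p, -⟩ := G.exists_walk_ball v r a
    obtain ⟨q, -⟩ := G.exists_walk_ball v r b
    exact ⟨p.reverse.append q⟩

theorem ball_radiusLE (G : FinGraph.{u}) (v : G.V) (r : ℕ) : (G.ball v r).RadiusLE r := by
  intro w
  obtain ⟨p, hp⟩ := G.exists_walk_ball v r w
  exact (SimpleGraph.Walk.edist_le p).trans (by exact_mod_cast hp)

/-- The isomorphism class of the `r`-ball centred at `v`. -/
def neighbourhood (G : FinGraph.{u}) (r : ℕ) (v : G.V) : Neighbourhood.{u} r :=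
  Quotient.mk _ ⟨G.ball v r, G.ball_radiusLE v r⟩

/-- The probability that the `r`-ball centred at a uniform random vertex of `G` is isomorphic
to `α`. -/
noncomputable def ballProb (G : FinGraph.{u}) (α : RootedGraph.{u}) (r : ℕ) : ℝ :=
  ({v : G.V | (G.ball v r).IsIso α}.ncard : ℝ) / (G.order : ℝ)

end FinGraph

/-- A graph sequence is bounded-degree if a single number bounds all degrees of all its members. -/
def BoundedDegree (G : ℕ → FinGraph.{u}) : Prop := ∃ Δ : ℕ, ∀ n, (G n).MaxDegLE Δ

/-- Benjamini–Schramm convergence: the sequence is bounded-degree, and all ball probabilities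
converge. -/
def BSConvergent (G : ℕ → FinGraph.{u}) : Prop :=
  BoundedDegree G ∧ ∀ (α : RootedGraph.{u}) (r : ℕ), 0 < r →
    ∃ p : ℝ, Tendsto (fun n => (G n).ballProb α r) atTop (𝓝 p)

/-- A graph parameter `f` is estimable on a class `C` of graphs: it is bounded on `C`, and for every
`ε > 0` there are positive integers `k`, `r` and an estimator `g`, a function of `k` many
`r`-neighbourhoods, such that for every `G` in `C` and independent uniform random vertices
`x 0, …, x (k - 1)` of `G`, the probability that `f G` differs by more than `ε` from the value of
`g` at the `r`-neighbourhoods of these vertices is at most `ε`. The probability is written as the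
proportion among all `k`-tuples of vertices. -/
def IsEstimableOn (C : Set FinGraph.{u}) (f : FinGraph.{u} → ℝ) : Prop :=
  (∃ M : ℝ, ∀ G ∈ C, |f G| ≤ M) ∧
    ∀ ε : ℝ, 0 < ε → ∃ k r : ℕ, 0 < k ∧ 0 < r ∧ ∃ g : (Fin k → Neighbourhood.{u} r) → ℝ,
      ∀ G ∈ C,
        ({x : Fin k → G.V | ε < |f G - g (fun i => G.neighbourhood r (x i))|}.ncard : ℝ) /
          (Nat.card (Fin k → G.V) : ℝ) ≤ ε

end EulerOr

/-!
Choose half of the neighbours of every vertex as candidates for its out-neighbours. The choice `s`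
is an Eulerian orientation if and only if the two endpoints of every edge disagree about it, and
the proportion of such choices is the average of `∏ e, (1 - σ s e) / 2` with a sign `σ s e` for
every edge. Expanding the product gives `2 ^ e(G) * ε(G) = (∏ v, (d v).choose (d v / 2)) * F 1`,
where `F` is a polynomial with nonnegative coefficients and `F 0 = 1`, a sum over the edge sets of
`G` of products of vertex weights. With one variable at every dart, the average factors over the
vertices into elementary symmetric averages, which do not vanish in the open unit disc by
Gauss–Lucas. Asano contraction of the two darts of an edge transfers this to `F`, so that
`log (F x)` is close to its Taylor polynomial for `0 < x < 1`, and `log (F 1) - log (F x)` is at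
most `e(G) * -log x`.

As `F` is multiplicative over disjoint vertex sets without edges between them, the Möbius transform
of a coefficient of `log F` vanishes on vertex sets that are large or do not induce a connected
subgraph. The coefficient is therefore a sum over the vertices of quantities that depend only on
a neighbourhood, so that the average over the vertices of a function of their neighbourhoods
approximates `log ε(G) / v(G)`. Benjamini–Schramm convergence and sampling both determine
such averages.
-/

namespace EulerOr

section Contraction

theorem ne_zero_of_forall_quadratic_ne_zero {a b c z : ℂ}
    (h : ∀ t : ℂ, ‖t‖ < 1 → a + b * t + c * t ^ 2 ≠ 0) (hz : ‖z‖ < 1) : a + c * z ≠ 0 := by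
  intro hacz
  obtain rfl | hc := eq_or_ne c 0
  · exact h 0 (by simp) (by simpa using hacz)
  obtain ⟨s, hs⟩ := IsAlgClosed.exists_pow_nat_eq (b ^ 2 - 4 * c * a) two_pos
  have root₁ : a + b * ((-b + s) / (2 * c)) + c * ((-b + s) / (2 * c)) ^ 2 = 0 := by
    field_simp; linear_combination hs
  have root₂ : a + b * ((-b - s) / (2 * c)) + c * ((-b - s) / (2 * c)) ^ 2 = 0 := by
    field_simp; linear_combination hs
  have vieta : (-b + s) / (2 * c) * ((-b - s) / (2 * c)) = -z := by
    field_simp; linear_combination -hs + 4 * c * hacz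
  have hle : 1 ≤ ‖(-b + s) / (2 * c) * ((-b - s) / (2 * c))‖ := by
    rw [norm_mul]
    exact one_le_mul_of_one_le_of_one_le (not_lt.1 fun hlt => h _ hlt root₁)
      (not_lt.1 fun hlt => h _ hlt root₂)
  rw [vieta, norm_neg] at hle
  exact hle.not_gt hz

theorem asano_contraction {Ω ι : Type*} (s : Finset Ω) (ρ τ : ι → Ω → ℂ) (E : Finset ι)
    (W : Ω → ℂ)
    (h : ∀ t : ι → ℂ, (∀ e, ‖t e‖ < 1) →
      ∑ x ∈ s, W x * ∏ e ∈ E, (1 + ρ e x * t e + τ e x * t e ^ 2) ≠ 0)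
    {z : ℂ} (hz : ‖z‖ < 1) :
    ∑ x ∈ s, W x * ∏ e ∈ E, (1 + τ e x * z) ≠ 0 := by
  classical
  induction E using Finset.induction_on generalizing W with
  | empty => simpa using h 0 (by simp)
  | insert e E he ih =>
    simp only [Finset.prod_insert he, ← mul_assoc] at h ⊢
    refine ih _ fun t ht => ?_
    set U : Ω → ℂ := fun x => W x * ∏ e ∈ E, (1 + ρ e x * t e + τ e x * t e ^ 2)
    have quadratic_ne_zero (u : ℂ) (hu : ‖u‖ < 1) :
        (∑ x ∈ s, U x) + (∑ x ∈ s, U x * ρ e x) * u + (∑ x ∈ s, U x * τ e x) * u ^ 2 ≠ 0 := by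
      have key := h (Function.update t e u)
        ((Function.forall_update_iff t fun _ x => ‖x‖ < 1).2 ⟨hu, fun e' _ => ht e'⟩)
      have prod_update (x : Ω) : ∏ i ∈ E, (1 + ρ i x * Function.update t e u i +
          τ i x * Function.update t e u i ^ 2) = ∏ i ∈ E, (1 + ρ i x * t i + τ i x * t i ^ 2) :=
        Finset.prod_congr rfl fun i hi => by
          rw [Function.update_of_ne (ne_of_mem_of_not_mem hi he)]
      simp only [prod_update, Function.update_self] at key
      convert key using 1
      simp only [Finset.sum_mul, ← Finset.sum_add_distrib]
      exact Finset.sum_congr rfl fun x _ => by ring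
    convert ne_zero_of_forall_quadratic_ne_zero quadratic_ne_zero hz using 1
    rw [Finset.sum_mul, ← Finset.sum_add_distrib]
    exact Finset.sum_congr rfl fun x _ => by ring

end Contraction

section GaussLucas

open Polynomial

theorem rootSet_iterate_derivative_subset {P : ℂ[X]} {s : Set ℂ} (hs : Convex ℝ s)
    (hP : P.rootSet ℂ ⊆ s) (m : ℕ) : (derivative^[m] P).rootSet ℂ ⊆ s := by
  induction m with
  | zero => exact hP
  | succ m ih =>
    rw [Function.iterate_succ_apply']
    obtain hdeg | hdeg := le_or_gt (derivative^[m] P).degree 0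
    · simp [derivative_of_natDegree_zero (natDegree_eq_zero_iff_degree_le_zero.2 hdeg)]
    · exact (rootSet_derivative_subset_convexHull_rootSet hdeg).trans (convexHull_min ih hs)

theorem coeff_ne_zero_of_rootSet_subset {P : ℂ[X]} {s : Set ℂ} (hs : Convex ℝ s)
    (hs0 : (0 : ℂ) ∉ s) (hP : P.rootSet ℂ ⊆ s) (hP0 : P ≠ 0) {m : ℕ} (hm : m ≤ P.natDegree) :
    P.coeff m ≠ 0 := by
  intro hcoeff
  have hne : derivative^[m] P ≠ 0 := fun h => by
    have := congrArg (coeff · (P.natDegree - m)) h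
    simp [coeff_iterate_derivative, Nat.sub_add_cancel hm, hP0, Nat.descFactorial_eq_zero_iff_lt,
      hm.not_gt] at this
  refine hs0 (rootSet_iterate_derivative_subset hs hP m ((mem_rootSet_of_ne hne).2 ?_))
  simp [coe_aeval_eq_eval, ← coeff_zero_eq_eval_zero, coeff_iterate_derivative, hcoeff]

theorem coeff_prod_C_mul_X_add_C {ι R : Type*} [DecidableEq ι] [CommRing R] (N : Finset ι)
    (a b : ι → R) (m : ℕ) :
    (∏ i ∈ N, (C (a i) * X + C (b i))).coeff m =
      ∑ S ∈ N.powersetCard m, (∏ i ∈ S, a i) * ∏ i ∈ N \ S, b i := by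
  rw [Finset.prod_add, finsetSum_coeff, Finset.powersetCard_eq_filter, Finset.sum_filter]
  refine Finset.sum_congr rfl fun S _ => ?_
  rw [Finset.prod_mul_distrib, Finset.prod_const, ← map_prod, ← map_prod, mul_right_comm, ← C_mul,
    coeff_C_mul_X_pow]
  simp only [eq_comm]

theorem one_add_ne_zero_of_norm_lt_one {t : ℂ} (ht : ‖t‖ < 1) : 1 + t ≠ 0 := fun h => by
  simp [eq_neg_of_add_eq_zero_right h] at ht

theorem re_neg_of_one_sub_mul_add_one_add_eq_zero {t z : ℂ} (ht : ‖t‖ < 1)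
    (hz : (1 - t) * z + (1 + t) = 0) : z.re < 0 := by
  by_contra! hre
  have hsub : ‖1 - t‖ * ‖z - 1‖ = 2 := by
    rw [← norm_mul, show (1 - t) * (z - 1) = -2 by linear_combination hz]; simp
  have hadd : ‖1 - t‖ * ‖z + 1‖ = 2 * ‖t‖ := by
    rw [← norm_mul, show (1 - t) * (z + 1) = -2 * t by linear_combination hz]; simp
  have hle : ‖z - 1‖ ≤ ‖z + 1‖ := by
    rw [← sq_le_sq₀ (norm_nonneg _) (norm_nonneg _), ← Complex.normSq_eq_norm_sq,
      ← Complex.normSq_eq_norm_sq, Complex.normSq_apply, Complex.normSq_apply]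
    simp only [Complex.sub_re, Complex.sub_im, Complex.add_re, Complex.add_im, Complex.one_re,
      Complex.one_im]
    linarith
  linarith [mul_le_mul_of_nonneg_left hle (norm_nonneg (1 - t))]

theorem sum_powersetCard_prod_ne_zero {ι : Type*} [DecidableEq ι] (N : Finset ι) {t : ι → ℂ}
    (ht : ∀ i, ‖t i‖ < 1) {m : ℕ} (hm : m ≤ N.card) :
    ∑ S ∈ N.powersetCard m, ∏ i ∈ N, (1 + (if i ∈ S then -1 else 1) * t i) ≠ 0 := by
  have hlead (i : ι) : 1 - t i ≠ 0 := by
    simpa [sub_eq_add_neg] using one_add_ne_zero_of_norm_lt_one (t := -t i) (by simpa using ht i)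
  have hfactor (i : ι) : C (1 - t i) * X + C (1 + t i) ≠ 0 := fun h => by
    simpa only [natDegree_linear (hlead i), natDegree_zero, one_ne_zero] using congrArg natDegree h
  have hdeg : (∏ i ∈ N, (C (1 - t i) * X + C (1 + t i))).natDegree = N.card := by
    rw [natDegree_prod _ _ fun i _ => hfactor i,
      Finset.sum_congr rfl fun i _ => natDegree_linear (hlead i), Finset.card_eq_sum_ones]
  have hroots : (∏ i ∈ N, (C (1 - t i) * X + C (1 + t i))).rootSet ℂ ⊆ {z : ℂ | z.re < 0} := by
    intro z hz
    have hz0 := (mem_rootSet.1 hz).2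
    rw [coe_aeval_eq_eval, eval_prod] at hz0
    obtain ⟨i, -, hi⟩ := Finset.prod_eq_zero_iff.1 hz0
    exact re_neg_of_one_sub_mul_add_one_add_eq_zero (ht i) (by simpa using hi)
  have hcoeff := coeff_ne_zero_of_rootSet_subset (convex_halfSpace_re_lt 0) (by simp) hroots
    (Finset.prod_ne_zero_iff.2 fun i _ => hfactor i) (hdeg ▸ hm)
  rw [coeff_prod_C_mul_X_add_C] at hcoeff
  convert hcoeff using 2 with S hS
  rw [← Finset.prod_sdiff (Finset.mem_powersetCard.1 hS).1, mul_comm]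
  congr 1 <;> refine Finset.prod_congr rfl fun i hi => ?_
  · simp [hi, sub_eq_add_neg]
  · simp [(Finset.mem_sdiff.1 hi).2]

end GaussLucas

section LogCoeff

open Polynomial

variable {K : Type*} [Field K]

/-- The coefficients of the logarithmic derivative `P' / P`, as a power series; that of degree `k`
is `k + 1` times the coefficient of degree `k + 1` of `log P`. -/
noncomputable def logCoeff (P : K[X]) (k : ℕ) : K :=
  PowerSeries.coeff k (PowerSeries.derivative K (P : PowerSeries K) * (P : PowerSeries K)⁻¹)

theorem coe_mul_coe_inv_of_coeff_zero {P : K[X]} (hP : P.coeff 0 = 1) :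
    (P : PowerSeries K) * (P : PowerSeries K)⁻¹ = 1 := by
  refine PowerSeries.mul_inv_cancel _ ?_
  rw [← PowerSeries.coeff_zero_eq_constantCoeff_apply, coeff_coe, hP]
  exact one_ne_zero

theorem logCoeff_mul {P Q : K[X]} (hP : P.coeff 0 = 1) (hQ : Q.coeff 0 = 1) (k : ℕ) :
    logCoeff (P * Q) k = logCoeff P k + logCoeff Q k := by
  simp only [logCoeff, ← map_add, coe_mul, PowerSeries.mul_inv_rev, Derivation.leibniz,
    smul_eq_mul]
  congr 1
  linear_combination PowerSeries.derivative K (Q : PowerSeries K) * (Q : PowerSeries K)⁻¹ *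
    coe_mul_coe_inv_of_coeff_zero hP + PowerSeries.derivative K (P : PowerSeries K) *
      (P : PowerSeries K)⁻¹ * coe_mul_coe_inv_of_coeff_zero hQ

theorem logCoeff_one (k : ℕ) : logCoeff (1 : K[X]) k = 0 := by
  simp [logCoeff]

theorem logCoeff_recursion {P : K[X]} (hP : P.coeff 0 = 1) (k : ℕ) :
    logCoeff P k = (k + 1) * P.coeff (k + 1) -
      ∑ i ∈ Finset.range k, logCoeff P i * P.coeff (k - i) := by
  have hderiv : PowerSeries.derivative K (P : PowerSeries K) * (P : PowerSeries K)⁻¹ * P =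
      PowerSeries.derivative K (P : PowerSeries K) := by
    linear_combination PowerSeries.derivative K (P : PowerSeries K) *
      coe_mul_coe_inv_of_coeff_zero hP
  have hcoeff := congrArg (PowerSeries.coeff k) hderiv
  rw [PowerSeries.coeff_mul, PowerSeries.coeff_derivative,
    Finset.Nat.sum_antidiagonal_eq_sum_range_succ_mk, Finset.sum_range_succ] at hcoeff
  simp only [coeff_coe, Nat.sub_self, hP] at hcoeff
  simp only [logCoeff]
  linear_combination hcoeff

theorem logCoeff_map {L : Type*} [Field L] (f : K →+* L) {P : K[X]} (hP : P.coeff 0 = 1) (k : ℕ) :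
    logCoeff (P.map f) k = f (logCoeff P k) := by
  induction k using Nat.strong_induction_on with
  | _ k ih =>
    rw [logCoeff_recursion hP, logCoeff_recursion (by simp [hP])]
    simp only [coeff_map, map_sub, map_mul, map_add, map_natCast, map_one, map_sum]
    congr 1
    exact Finset.sum_congr rfl fun i hi => by rw [ih i (Finset.mem_range.1 hi)]

theorem logCoeff_one_sub_C_mul_X (a : K) (k : ℕ) :
    logCoeff (1 - C a * X) k = -a ^ (k + 1) := by
  induction k using Nat.strong_induction_on with
  | _ k ih =>
    rw [logCoeff_recursion (by simp)]
    cases k with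
    | zero => simp [coeff_one]
    | succ k =>
      rw [Finset.sum_range_succ, Finset.sum_eq_zero, ih k (by lia)]
      · simp [coeff_one]; ring
      · intro i hi
        have hi' := Finset.mem_range.1 hi
        rw [show k + 1 - i = k - i - 1 + 1 + 1 by lia]
        simp [coeff_one]

theorem logCoeff_one_sub_C_mul_X_mul (a : K) {P : K[X]} (hP : P.coeff 0 = 1) (k : ℕ) :
    logCoeff ((1 - C a * X) * P) k = logCoeff P k - a ^ (k + 1) := by
  rw [logCoeff_mul (by simp) hP, logCoeff_one_sub_C_mul_X, neg_add_eq_sub]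

theorem coeff_zero_prod_one_sub_C_mul_X (s : Multiset K) :
    (s.map fun a => 1 - C a * X).prod.coeff 0 = 1 := by
  simp [coeff_zero_eq_eval_zero, eval_multiset_prod]

theorem eq_prod_one_sub_C_inv_mul_X {P : K[X]} (hsplit : P.Splits) (hP : P.coeff 0 = 1) :
    P = ((P.roots.map fun r => r⁻¹).map fun a => 1 - C a * X).prod := by
  have hfactor : ∀ r ∈ P.roots, X - C r = C (-r) * (1 - C r⁻¹ * X) := fun r hr => by
    have hr0 : r ≠ 0 := by
      rintro rfl
      have hroot : P.eval 0 = 0 := isRoot_of_mem_roots hr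
      rw [← coeff_zero_eq_eval_zero, hP] at hroot
      exact one_ne_zero hroot
    rw [mul_sub, ← mul_assoc, ← C_mul, neg_mul, mul_inv_cancel₀ hr0]
    simp [sub_eq_add_neg, add_comm]
  have hprod : P = C (P.leadingCoeff * (P.roots.map fun r => -r).prod) *
      ((P.roots.map fun r => r⁻¹).map fun a => 1 - C a * X).prod := by
    conv_lhs => rw [hsplit.eq_prod_roots, Multiset.map_congr rfl hfactor, Multiset.prod_map_mul]
    rw [C_mul, mul_assoc, map_multiset_prod, Multiset.map_map, Multiset.map_map]
    rfl
  have hconst : P.leadingCoeff * (P.roots.map fun r => -r).prod = 1 := by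
    have h := congrArg (coeff · 0) hprod
    rwa [coeff_C_mul, coeff_zero_prod_one_sub_C_mul_X, mul_one, hP, eq_comm] at h
  rwa [hconst, C_1, one_mul] at hprod

end LogCoeff

section TruncatedLog

open Polynomial

theorem logTaylor_neg (w : ℂ) (K : ℕ) :
    Complex.logTaylor (K + 1) (-w) = -∑ k ∈ Finset.range K, w ^ (k + 1) / (k + 1) := by
  rw [Complex.logTaylor, Finset.sum_range_succ', ← Finset.sum_neg_distrib]
  simp only [Nat.cast_zero, div_zero, add_zero]
  refine Finset.sum_congr rfl fun k _ => ?_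
  rw [neg_pow w (k + 1), ← mul_assoc, ← pow_add, Odd.neg_one_pow ⟨k + 1, by ring⟩]
  push_cast
  ring

theorem abs_log_norm_one_sub_add_le {w : ℂ} {ρ : ℝ} (hw : ‖w‖ ≤ ρ) (hρ : ρ < 1) (K : ℕ) :
    |Real.log ‖1 - w‖ + (∑ k ∈ Finset.range K, w ^ (k + 1) / (k + 1)).re| ≤
      ρ ^ (K + 1) / (1 - ρ) := by
  have hw1 : 0 < 1 - ‖w‖ := by linarith
  have hρ0 : 0 ≤ ρ := (norm_nonneg w).trans hw
  have htaylor := Complex.norm_log_sub_logTaylor_le K (z := -w) (by rw [norm_neg]; linarith)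
  rw [logTaylor_neg, norm_neg, sub_neg_eq_add, ← sub_eq_add_neg] at htaylor
  rw [← Complex.log_re, ← Complex.add_re]
  refine (Complex.abs_re_le_norm _).trans (htaylor.trans ?_)
  rw [← div_eq_mul_inv]
  calc ‖w‖ ^ (K + 1) / (1 - ‖w‖) / (K + 1) ≤ ‖w‖ ^ (K + 1) / (1 - ‖w‖) :=
        div_le_self (by positivity) (by simp)
    _ ≤ ρ ^ (K + 1) / (1 - ρ) := by gcongr

theorem abs_log_norm_eval_prod_sub_le {s : Multiset ℂ} (hs : ∀ a ∈ s, ‖a‖ ≤ 1) {z : ℂ}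
    (hz : ‖z‖ < 1) (K : ℕ) :
    |Real.log ‖(s.map fun a => 1 - C a * X).prod.eval z‖ - (∑ k ∈ Finset.range K,
      logCoeff (s.map fun a => 1 - C a * X).prod k * z ^ (k + 1) / (k + 1)).re| ≤
      s.card * (‖z‖ ^ (K + 1) / (1 - ‖z‖)) := by
  have hnorm : ∀ a ∈ s, ‖a * z‖ ≤ ‖z‖ := fun a ha => by
    simpa using mul_le_of_le_one_left (norm_nonneg z) (hs a ha)
  induction s using Multiset.induction_on with
  | empty => simp [logCoeff_one]
  | cons a s ih =>
    rw [Multiset.forall_mem_cons] at hs hnorm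
    have hne : ∀ b, ‖b * z‖ ≤ ‖z‖ → 1 - b * z ≠ 0 := fun b hb h => by
      rw [← sub_eq_zero.1 h, norm_one] at hb
      exact hb.not_gt hz
    have hne_s : (s.map fun a => 1 - C a * X).prod.eval z ≠ 0 := by
      simpa [eval_multiset_prod, Multiset.prod_eq_zero_iff] using
        fun b hb => hne b (hnorm.2 b hb)
    have hsum : (∑ k ∈ Finset.range K,
        logCoeff ((a ::ₘ s).map fun a => 1 - C a * X).prod k * z ^ (k + 1) / (k + 1)) =
        -(∑ k ∈ Finset.range K, (a * z) ^ (k + 1) / (k + 1)) + ∑ k ∈ Finset.range K,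
          logCoeff (s.map fun a => 1 - C a * X).prod k * z ^ (k + 1) / (k + 1) := by
      rw [← Finset.sum_neg_distrib, ← Finset.sum_add_distrib]
      refine Finset.sum_congr rfl fun k _ => ?_
      rw [Multiset.map_cons, Multiset.prod_cons,
        logCoeff_one_sub_C_mul_X_mul a (coeff_zero_prod_one_sub_C_mul_X s)]
      ring
    have hlog : Real.log ‖((a ::ₘ s).map fun a => 1 - C a * X).prod.eval z‖ =
        Real.log ‖1 - a * z‖ + Real.log ‖(s.map fun a => 1 - C a * X).prod.eval z‖ := by
      rw [← Real.log_mul (norm_ne_zero_iff.2 (hne a hnorm.1)) (norm_ne_zero_iff.2 hne_s),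
        ← norm_mul]
      simp
    rw [hsum, hlog, Complex.add_re, Complex.neg_re, Multiset.card_cons]
    push_cast
    refine le_trans (le_of_eq ?_)
      ((abs_add_le _ _).trans (add_le_add (abs_log_norm_one_sub_add_le hnorm.1 hz K)
        (ih hs.2 hnorm.2))) |>.trans_eq (by ring)
    congr 1; ring

theorem abs_log_norm_eval_sub_sum_logCoeff_le {P : ℂ[X]} (hP : P.coeff 0 = 1)
    (hne : ∀ z : ℂ, ‖z‖ < 1 → P.eval z ≠ 0) {z : ℂ} (hz : ‖z‖ < 1) (K : ℕ) :
    |Real.log ‖P.eval z‖ - (∑ k ∈ Finset.range K, logCoeff P k * z ^ (k + 1) / (k + 1)).re| ≤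
      P.natDegree * (‖z‖ ^ (K + 1) / (1 - ‖z‖)) := by
  have hfactor := eq_prod_one_sub_C_inv_mul_X (IsAlgClosed.splits P) hP
  have hinv : ∀ a ∈ P.roots.map (·⁻¹), ‖a‖ ≤ 1 := by
    simp only [Multiset.mem_map, forall_exists_index, and_imp, forall_apply_eq_imp_iff₂, norm_inv]
    exact fun r hr => inv_le_one_of_one_le₀ (not_lt.1 fun hlt => hne r hlt (isRoot_of_mem_roots hr))
  have hbound := abs_log_norm_eval_prod_sub_le hinv hz K
  rw [← hfactor, Multiset.card_map] at hbound
  refine hbound.trans ?_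
  have : 0 < 1 - ‖z‖ := by linarith
  gcongr
  exact card_roots' P

theorem abs_log_eval_sub_sum_logCoeff_le {P : ℝ[X]} (hP : P.coeff 0 = 1)
    (hne : ∀ z : ℂ, ‖z‖ < 1 → aeval z P ≠ 0) {x : ℝ} (hx : |x| < 1) (K : ℕ) :
    |Real.log (P.eval x) - ∑ k ∈ Finset.range K, logCoeff P k * x ^ (k + 1) / (k + 1)| ≤
      P.natDegree * (|x| ^ (K + 1) / (1 - |x|)) := by
  have hbound := abs_log_norm_eval_sub_sum_logCoeff_le (P := P.map (algebraMap ℝ ℂ))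
    (by simp [hP]) (by simpa only [eval_map_algebraMap] using hne) (z := x) (by simpa using hx) K
  simp only [logCoeff_map _ hP, natDegree_map, Complex.norm_real, Real.norm_eq_abs] at hbound
  convert hbound using 3
  · rw [eval_map_algebraMap, ← Complex.coe_algebraMap, aeval_algebraMap_apply]
    simp
  · rw [← Complex.ofReal_re (∑ k ∈ _, _)]
    push_cast
    rfl

end TruncatedLog

section MiddleCoefficient

open Polynomial

theorem coeff_succ_one_sub_pow_add_two_mul {R : Type*} [CommRing R] (a b n : ℕ) :
    ((1 - X) ^ (a + 2) * (1 + X) ^ b : R[X]).coeff (n + 1) =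
      ((1 - X) ^ a * (1 + X) ^ (b + 2) : R[X]).coeff (n + 1) -
        4 * ((1 - X) ^ a * (1 + X) ^ b : R[X]).coeff n := by
  have h : ((1 - X) ^ (a + 2) * (1 + X) ^ b : R[X]) =
      (1 - X) ^ a * (1 + X) ^ (b + 2) - C 4 * (X * ((1 - X) ^ a * (1 + X) ^ b)) := by
    rw [show (C 4 : R[X]) = 4 from rfl]; ring
  rw [h, coeff_sub, coeff_C_mul, coeff_X_mul]

theorem coeff_one_sub_pow_odd_mul_one_add_pow_odd {R : Type*} [CommRing R] (j l : ℕ) :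
    ((1 - X) ^ (2 * j + 1) * (1 + X) ^ (2 * l + 1) : R[X]).coeff (j + l + 1) = 0 := by
  induction j generalizing l with
  | zero =>
    simp only [mul_zero, zero_add, pow_one, sub_mul, one_mul, coeff_sub, coeff_X_mul,
      coeff_one_add_X_pow]
    rw [Nat.choose_symm_of_eq_add (show 2 * l + 1 = (l + 1) + l by ring), sub_self]
  | succ j ih =>
    rw [show 2 * (j + 1) + 1 = 2 * j + 1 + 2 by ring, show j + 1 + l + 1 = j + l + 1 + 1 by ring,
      coeff_succ_one_sub_pow_add_two_mul, ih l, show 2 * l + 1 + 2 = 2 * (l + 1) + 1 by ring,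
      show j + l + 1 + 1 = j + (l + 1) + 1 by ring, ih (l + 1), mul_zero, sub_zero]

open Nat in
theorem coeff_one_sub_pow_even_mul_one_add_pow_even {K : Type*} [Field K] [CharZero K] (j l : ℕ) :
    ((1 - X) ^ (2 * j) * (1 + X) ^ (2 * l) : K[X]).coeff (j + l) =
      (-1) ^ j * (((2 * j)! * (2 * l)! : ℕ) : K) / ((j ! * l ! * (j + l)! : ℕ) : K) := by
  have factorial_ne_zero (n : ℕ) : (n ! : K) ≠ 0 := Nat.cast_ne_zero.2 (Nat.factorial_ne_zero n)
  induction j generalizing l with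
  | zero =>
    have := factorial_ne_zero l
    simp only [mul_zero, pow_zero, one_mul, zero_add, coeff_one_add_X_pow]
    rw [two_mul, Nat.cast_add_choose]
    push_cast
    simp
  | succ j ih =>
    rw [show 2 * (j + 1) = 2 * j + 2 by ring, show j + 1 + l = j + l + 1 by ring,
      coeff_succ_one_sub_pow_add_two_mul, ih l, show 2 * l + 2 = 2 * (l + 1) by ring,
      show j + l + 1 = j + (l + 1) by ring, ih (l + 1), show 2 * (l + 1) = 2 * l + 1 + 1 by ring,
      show 2 * j + 2 = 2 * j + 1 + 1 by ring, show j + (l + 1) = j + l + 1 by ring]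
    simp only [Nat.factorial_succ]
    have := factorial_ne_zero l
    have := factorial_ne_zero j
    have := factorial_ne_zero (j + l)
    have := Nat.cast_add_one_ne_zero (R := K) j
    have := Nat.cast_add_one_ne_zero (R := K) l
    have : (j + l + 1 : K) ≠ 0 := by exact_mod_cast (j + l).succ_ne_zero
    push_cast
    field_simp
    ring

/-- The absolute value of the central coefficient of `(1 - X) ^ k * (1 + X) ^ (d - k)`, divided by
that for `k = 0`, for even `d`: the weight of a vertex of degree `d` in a subgraph in which it has
degree `k`. -/
def vertexWeight (K : Type*) [Field K] (d k : ℕ) : K :=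
  if Even k then ((d / 2).choose (k / 2) : K) / (d.choose k : K) else 0

theorem vertexWeight_zero_right (K : Type*) [Field K] (d : ℕ) : vertexWeight K d 0 = 1 := by
  simp [vertexWeight]

theorem map_vertexWeight {K L : Type*} [Field K] [Field L] (f : K →+* L) (d k : ℕ) :
    f (vertexWeight K d k) = vertexWeight L d k := by
  simp [vertexWeight, apply_ite f]

theorem vertexWeight_nonneg {K : Type*} [Field K] [LinearOrder K] [IsStrictOrderedRing K]
    (d k : ℕ) : 0 ≤ vertexWeight K d k := by
  unfold vertexWeight
  split_ifs <;> positivity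

theorem choose_half_pos (d : ℕ) : 0 < d.choose (d / 2) := Nat.choose_pos (Nat.div_le_self d 2)

theorem coeff_half_one_sub_pow_mul_one_add_pow {K : Type*} [Field K] [CharZero K] {d k : ℕ}
    (hd : Even d) (hk : k ≤ d) :
    ((1 - X) ^ k * (1 + X) ^ (d - k) : K[X]).coeff (d / 2) =
      d.choose (d / 2) * ((-1) ^ (k / 2) * vertexWeight K d k) := by
  obtain ⟨m, rfl⟩ := hd
  obtain ⟨j, rfl | rfl⟩ := Nat.even_or_odd' k
  · obtain ⟨l, rfl⟩ : ∃ l, m = j + l := ⟨m - j, by lia⟩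
    have factorial_ne_zero (n : ℕ) : (n.factorial : K) ≠ 0 :=
      Nat.cast_ne_zero.2 (Nat.factorial_ne_zero n)
    rw [vertexWeight, if_pos (even_two_mul j), show j + l + (j + l) - 2 * j = 2 * l by lia,
      show (j + l + (j + l)) / 2 = j + l by lia, show 2 * j / 2 = j by lia,
      coeff_one_sub_pow_even_mul_one_add_pow_even, Nat.cast_add_choose, Nat.cast_add_choose,
      show j + l + (j + l) = 2 * j + 2 * l by ring, Nat.cast_add_choose]
    have := factorial_ne_zero j
    have := factorial_ne_zero l
    have := factorial_ne_zero (j + l)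
    have := factorial_ne_zero (2 * j)
    have := factorial_ne_zero (2 * l)
    have := factorial_ne_zero (2 * j + 2 * l)
    push_cast
    field_simp
  · obtain ⟨l, rfl⟩ : ∃ l, m = j + l + 1 := ⟨m - j - 1, by lia⟩
    rw [vertexWeight, if_neg (by simp), mul_zero, mul_zero,
      show j + l + 1 + (j + l + 1) - (2 * j + 1) = 2 * l + 1 by lia,
      show (j + l + 1 + (j + l + 1)) / 2 = j + l + 1 by lia,
      coeff_one_sub_pow_odd_mul_one_add_pow_odd]

theorem sum_powersetCard_prod_sign {ι R : Type*} [DecidableEq ι] [CommRing R] {N B : Finset ι}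
    (hB : B ⊆ N) (m : ℕ) :
    ∑ S ∈ N.powersetCard m, ∏ i ∈ B, (if i ∈ S then -1 else 1 : R) =
      ((1 - X) ^ B.card * (1 + X) ^ (N.card - B.card) : R[X]).coeff m := by
  have hprod : ∏ i ∈ N, (C (if i ∈ B then -1 else 1 : R) * X + C 1) =
      (1 - X) ^ B.card * (1 + X) ^ (N.card - B.card) := by
    have hterm (i : ι) : C (if i ∈ B then -1 else 1 : R) * X + C 1 =
        if i ∈ B then 1 - X else 1 + X := by
      split_ifs <;> simp [sub_eq_add_neg, add_comm]
    rw [Finset.prod_congr rfl fun i _ => hterm i, Finset.prod_ite, Finset.prod_const,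
      Finset.prod_const, Finset.filter_mem_eq_inter, Finset.inter_eq_right.2 hB,
      Finset.filter_notMem_eq_sdiff, Finset.card_sdiff_of_subset hB]
  rw [← hprod, coeff_prod_C_mul_X_add_C]
  refine Finset.sum_congr rfl fun S _ => ?_
  simp only [Finset.prod_const_one, mul_one, Finset.prod_ite, Finset.prod_const,
    Finset.filter_mem_eq_inter]
  rw [Finset.inter_comm]

theorem sum_powersetCard_half_prod_sign {ι K : Type*} [DecidableEq ι] [Field K] [CharZero K]
    {N B : Finset ι} (hN : Even N.card) (hB : B ⊆ N) :
    ∑ S ∈ N.powersetCard (N.card / 2), ∏ i ∈ B, (if i ∈ S then -1 else 1 : K) =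
      N.card.choose (N.card / 2) * ((-1) ^ (B.card / 2) * vertexWeight K N.card B.card) := by
  rw [sum_powersetCard_prod_sign hB,
    coeff_half_one_sub_pow_mul_one_add_pow hN (Finset.card_le_card hB)]

end MiddleCoefficient

section EdgeSets

variable {V : Type*} [DecidableEq V]

/-- The number of edges of `A` at `v`, that is the degree of `v` in the subgraph with edge
set `A`. -/
def incCount (A : Finset (Sym2 V)) (v : V) : ℕ := (A.filter fun e => v ∈ e).card

/-- The product of `f` over the two orientations of an edge. -/
def dartProd {M : Type*} [CommMonoid M] (f : V → V → M) : Sym2 V → M :=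
  Sym2.lift ⟨fun u v => f u v * f v u, fun _ _ => mul_comm _ _⟩

omit [DecidableEq V] in
theorem dartProd_mk {M : Type*} [CommMonoid M] (f : V → V → M) (u v : V) :
    dartProd f s(u, v) = f u v * f v u := rfl

theorem incCount_empty (v : V) : incCount ∅ v = 0 := rfl

variable [Fintype V]

theorem card_filter_mk_mem (A : Finset (Sym2 V)) (v : V) :
    (Finset.univ.filter fun w => s(v, w) ∈ A).card = incCount A v := by
  refine Finset.card_bij (fun w _ => s(v, w)) (fun w hw => by simpa using hw)
    (fun _ _ _ _ h => Sym2.congr_right.1 h) fun e he => ?_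
  rw [Finset.mem_filter] at he
  obtain ⟨w, rfl⟩ := Sym2.mem_iff_exists.1 he.2
  exact ⟨w, by simpa using he.1, rfl⟩

theorem prod_dartProd {M : Type*} [CommMonoid M] (f : V → V → M) {A : Finset (Sym2 V)}
    (hA : ∀ e ∈ A, ¬ e.IsDiag) :
    ∏ e ∈ A, dartProd f e = ∏ v : V, ∏ w : V with s(v, w) ∈ A, f v w := by
  simp only [Finset.prod_filter]
  rw [← Fintype.prod_prod_type' fun v w => if s(v, w) ∈ A then f v w else 1, ← Finset.prod_filter,
    ← Finset.prod_fiberwise_of_maps_to (t := A) (g := fun p : V × V => s(p.1, p.2))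
      fun p hp => (Finset.mem_filter.1 hp).2]
  refine Finset.prod_congr rfl fun e he => ?_
  induction e using Sym2.ind with
  | _ u v =>
    have hne : (u, v) ≠ (v, u) := fun h => hA _ he (congrArg Prod.fst h)
    have hfiber : {p ∈ Finset.univ.filter fun p : V × V => s(p.1, p.2) ∈ A | s(p.1, p.2) = s(u, v)}
        = {(u, v), (v, u)} := by
      ext ⟨x, y⟩
      have : s(x, y) = s(u, v) → s(x, y) ∈ A := fun h => h ▸ he
      simp only [Finset.mem_filter, Finset.mem_univ, true_and, Finset.mem_insert,
        Finset.mem_singleton, Prod.mk.injEq, ← Sym2.eq_iff]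
      exact and_iff_right_of_imp this
    rw [hfiber, Finset.prod_pair hne, dartProd_mk]

theorem sum_incCount {A : Finset (Sym2 V)} (hA : ∀ e ∈ A, ¬ e.IsDiag) :
    ∑ v, incCount A v = 2 * A.card := by
  have hdart (e : Sym2 V) : dartProd (fun _ _ => Multiplicative.ofAdd 1) e =
      Multiplicative.ofAdd 2 :=
    e.ind fun _ _ => rfl
  have h := congrArg Multiplicative.toAdd (prod_dartProd (fun _ _ => Multiplicative.ofAdd 1) hA)
  simp only [hdart, Finset.prod_const, toAdd_pow, toAdd_prod, toAdd_ofAdd, smul_eq_mul,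
    card_filter_mk_mem, mul_one] at h
  rw [← h, mul_comm]

end EdgeSets

section SubgraphPolynomial

open Polynomial

variable {V : Type*} [Fintype V] [DecidableEq V] {R : Type*} [CommRing R] (w : ℕ → ℕ → R)
  (G : SimpleGraph V) [DecidableRel G.Adj]

/-- The weight of the edge set `A` of `G`, where `w d k` is the weight of a vertex that has
degree `d` in `G` and degree `k` in `A`. -/
def edgeWeight (A : Finset (Sym2 V)) : R := ∏ v, w (G.degree v) (incCount A v)

/-- The edges of `G` inside the vertex set `S`. -/
def edgesIn (S : Finset V) : Finset (Sym2 V) := G.edgeFinset.filter (∀ v ∈ ·, v ∈ S)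

/-- The generating polynomial of the weights of the edge sets of `G` inside the vertex set `S`.
The degrees are still taken in `G`. -/
noncomputable def subgraphPoly (S : Finset V) : R[X] :=
  ∑ A ∈ (edgesIn G S).powerset, C (edgeWeight w G A) * X ^ A.card

variable {w G}

theorem edgesIn_univ : edgesIn G Finset.univ = G.edgeFinset := by
  simp [edgesIn]

theorem edgeWeight_empty (hw : ∀ d, w d 0 = 1) : edgeWeight w G ∅ = 1 := by
  simp [edgeWeight, incCount_empty, hw]

theorem coeff_subgraphPoly (S : Finset V) (j : ℕ) :
    (subgraphPoly w G S).coeff j = ∑ A ∈ (edgesIn G S).powersetCard j, edgeWeight w G A := by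
  rw [subgraphPoly, finsetSum_coeff, Finset.powersetCard_eq_filter, Finset.sum_filter]
  refine Finset.sum_congr rfl fun A _ => ?_
  rw [coeff_C_mul_X_pow]
  simp only [eq_comm]

theorem coeff_zero_subgraphPoly (hw : ∀ d, w d 0 = 1) (S : Finset V) :
    (subgraphPoly w G S).coeff 0 = 1 := by
  simp [coeff_subgraphPoly, edgeWeight_empty hw]

theorem natDegree_subgraphPoly_univ_le :
    (subgraphPoly w G Finset.univ).natDegree ≤ G.edgeFinset.card := by
  rw [subgraphPoly, edgesIn_univ]
  exact natDegree_sum_le_of_forall_le _ _ fun A hA =>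
    (natDegree_C_mul_X_pow_le _ _).trans (Finset.card_le_card (Finset.mem_powerset.1 hA))

theorem eval_subgraphPoly_univ (z : R) : (subgraphPoly w G Finset.univ).eval z =
    ∑ A ∈ G.edgeFinset.powerset, edgeWeight w G A * z ^ A.card := by
  simp [subgraphPoly, edgesIn_univ, eval_finsetSum]

theorem map_subgraphPoly {R' : Type*} [CommRing R'] (f : R →+* R') (S : Finset V) :
    (subgraphPoly w G S).map f = subgraphPoly (fun d k => f (w d k)) G S := by
  simp only [subgraphPoly, edgeWeight, Polynomial.map_sum, Polynomial.map_mul, Polynomial.map_pow,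
    Polynomial.map_C, Polynomial.map_X, map_prod, Polynomial.map_prod]

theorem edgeWeight_nonneg {R : Type*} [CommRing R] [LinearOrder R] [IsStrictOrderedRing R]
    {w : ℕ → ℕ → R} (hw : ∀ d k, 0 ≤ w d k) (A : Finset (Sym2 V)) : 0 ≤ edgeWeight w G A :=
  Finset.prod_nonneg fun _ _ => hw _ _

theorem one_le_eval_subgraphPoly_univ {R : Type*} [CommRing R] [LinearOrder R]
    [IsStrictOrderedRing R] {w : ℕ → ℕ → R} (hw : ∀ d k, 0 ≤ w d k) (hw0 : ∀ d, w d 0 = 1)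
    {x : R} (hx : 0 ≤ x) : 1 ≤ (subgraphPoly w G Finset.univ).eval x := by
  rw [eval_subgraphPoly_univ]
  simpa [edgeWeight_empty hw0] using
    Finset.single_le_sum (f := fun A => edgeWeight w G A * x ^ A.card)
      (fun A _ => mul_nonneg (edgeWeight_nonneg hw A) (pow_nonneg hx _))
      (Finset.empty_mem_powerset G.edgeFinset)

theorem eval_subgraphPoly_univ_mono {R : Type*} [CommRing R] [LinearOrder R]
    [IsStrictOrderedRing R] {w : ℕ → ℕ → R} (hw : ∀ d k, 0 ≤ w d k)
    {x y : R} (hx : 0 ≤ x) (hxy : x ≤ y) :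
    (subgraphPoly w G Finset.univ).eval x ≤ (subgraphPoly w G Finset.univ).eval y := by
  simp only [eval_subgraphPoly_univ]
  exact Finset.sum_le_sum fun A _ =>
    mul_le_mul_of_nonneg_left (pow_le_pow_left₀ hx hxy _) (edgeWeight_nonneg hw A)

theorem pow_mul_eval_one_subgraphPoly_univ_le {R : Type*} [CommRing R] [LinearOrder R]
    [IsStrictOrderedRing R] {w : ℕ → ℕ → R} (hw : ∀ d k, 0 ≤ w d k)
    {x : R} (hx0 : 0 ≤ x) (hx1 : x ≤ 1) :
    x ^ G.edgeFinset.card * (subgraphPoly w G Finset.univ).eval 1 ≤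
      (subgraphPoly w G Finset.univ).eval x := by
  simp only [eval_subgraphPoly_univ, Finset.mul_sum, one_pow, mul_one]
  refine Finset.sum_le_sum fun A hA => ?_
  rw [mul_comm]
  exact mul_le_mul_of_nonneg_left (pow_le_pow_of_le_one hx0 hx1
    (Finset.card_le_card (Finset.mem_powerset.1 hA))) (edgeWeight_nonneg hw A)

end SubgraphPolynomial

section HalfChoices

open Polynomial

theorem not_isDiag_of_subset_edgeFinset {V : Type*} {G : SimpleGraph V} [Fintype G.edgeSet]
    {A : Finset (Sym2 V)} (hA : A ⊆ G.edgeFinset) :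
    ∀ e ∈ A, ¬ e.IsDiag := fun _ he =>
  G.not_isDiag_of_mem_edgeSet (SimpleGraph.mem_edgeFinset.1 (hA he))

variable {V : Type*} [Fintype V] [DecidableEq V] (G : SimpleGraph V) [DecidableRel G.Adj]

/-- The choices of half of the neighbours of every vertex, as candidates for the out-neighbourhoods
of an Eulerian orientation. -/
def halfChoices : Finset (V → Finset V) :=
  Fintype.piFinset fun v => (G.neighborFinset v).powersetCard (G.degree v / 2)

/-- The sign of the dart from `v` to `w` in the choice `s`. An edge is oriented consistently by the
two choices at its ends if and only if its two darts have opposite signs. -/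
def dartSign {V : Type*} [DecidableEq V] (R : Type*) [Ring R] (s : V → Finset V) (v w : V) : R :=
  if w ∈ s v then -1 else 1

variable {G}

theorem card_halfChoices : (halfChoices G).card = ∏ v, (G.degree v).choose (G.degree v / 2) := by
  simp [halfChoices, Fintype.card_piFinset]

theorem card_halfChoices_pos : 0 < (halfChoices G).card := by
  rw [card_halfChoices]
  exact Finset.prod_pos fun v _ => choose_half_pos _

theorem prod_neg_one_pow_half_mul_vertexWeight (K : Type*) [Field K] {A : Finset (Sym2 V)}
    (hA : ∀ e ∈ A, ¬ e.IsDiag) (d : V → ℕ) :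
    ∏ v, ((-1) ^ (incCount A v / 2) * vertexWeight K (d v) (incCount A v)) =
      (-1) ^ A.card * ∏ v, vertexWeight K (d v) (incCount A v) := by
  rw [Finset.prod_mul_distrib]
  by_cases heven : ∀ v, Even (incCount A v)
  · have hcard : ∑ v, incCount A v / 2 = A.card := by
      have hsum := sum_incCount hA
      rw [← Finset.sum_congr rfl fun v _ => Nat.two_mul_div_two_of_even (heven v),
        ← Finset.mul_sum] at hsum
      lia
    rw [Finset.prod_pow_eq_pow_sum, hcard]
  · push Not at heven
    obtain ⟨v, hv⟩ := heven
    have hzero : ∏ v, vertexWeight K (d v) (incCount A v) = 0 :=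
      Finset.prod_eq_zero (Finset.mem_univ v) (if_neg hv)
    rw [hzero, mul_zero, mul_zero]

variable {K : Type*} [Field K] [CharZero K]

theorem sum_halfChoices_prod_dartProd (hG : ∀ v, Even (G.degree v)) {A : Finset (Sym2 V)}
    (hA : A ⊆ G.edgeFinset) :
    ∑ s ∈ halfChoices G, ∏ e ∈ A, dartProd (dartSign K s) e =
      (halfChoices G).card * ((-1) ^ A.card * edgeWeight (vertexWeight K) G A) := by
  have hdiag := not_isDiag_of_subset_edgeFinset hA
  have hvertex (v : V) : ∑ S ∈ (G.neighborFinset v).powersetCard (G.degree v / 2),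
      ∏ w : V with s(v, w) ∈ A, (if w ∈ S then -1 else 1 : K) =
      (G.degree v).choose (G.degree v / 2) *
        ((-1) ^ (incCount A v / 2) * vertexWeight K (G.degree v) (incCount A v)) := by
    rw [← card_filter_mk_mem, ← G.card_neighborFinset_eq_degree]
    refine sum_powersetCard_half_prod_sign (by simpa using hG v) fun w hw => ?_
    simpa using hA (Finset.mem_filter.1 hw).2
  calc ∑ s ∈ halfChoices G, ∏ e ∈ A, dartProd (dartSign K s) e
    _ = ∑ s ∈ halfChoices G, ∏ v, ∏ w : V with s(v, w) ∈ A, (if w ∈ s v then -1 else 1 : K) :=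
        Finset.sum_congr rfl fun s _ => prod_dartProd _ hdiag
    _ = ∏ v, ∑ S ∈ (G.neighborFinset v).powersetCard (G.degree v / 2),
          ∏ w : V with s(v, w) ∈ A, (if w ∈ S then -1 else 1 : K) := by
        rw [Finset.prod_univ_sum, halfChoices]
    _ = (halfChoices G).card * ((-1) ^ A.card * edgeWeight (vertexWeight K) G A) := by
        rw [Finset.prod_congr rfl fun v _ => hvertex v, Finset.prod_mul_distrib,
          prod_neg_one_pow_half_mul_vertexWeight K hdiag, card_halfChoices, Nat.cast_prod,
          edgeWeight]

theorem sum_halfChoices_prod_one_add (hG : ∀ v, Even (G.degree v)) (z : K) :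
    ∑ s ∈ halfChoices G, ∏ e ∈ G.edgeFinset, (1 + dartProd (dartSign K s) e * z) =
      (halfChoices G).card * (subgraphPoly (vertexWeight K) G Finset.univ).eval (-z) := by
  simp only [Finset.prod_one_add, Finset.prod_mul_distrib, Finset.prod_const]
  rw [Finset.sum_comm, eval_subgraphPoly_univ, Finset.mul_sum]
  refine Finset.sum_congr rfl fun A hA => ?_
  rw [← Finset.sum_mul, sum_halfChoices_prod_dartProd hG (Finset.mem_powerset.1 hA), neg_pow z]
  ring

theorem sum_halfChoices_prod_one_add_dartSign_ne_zero {t : Sym2 V → ℂ} (ht : ∀ e, ‖t e‖ < 1) :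
    ∑ s ∈ halfChoices G, ∏ e ∈ G.edgeFinset,
      dartProd (fun v w => 1 + dartSign ℂ s v w * t s(v, w)) e ≠ 0 := by
  have hneighbor (v : V) : (Finset.univ.filter fun w => s(v, w) ∈ G.edgeFinset) =
      G.neighborFinset v := by
    ext w; simp
  simp only [prod_dartProd _ (not_isDiag_of_subset_edgeFinset subset_rfl), hneighbor, dartSign]
  rw [halfChoices, ← Finset.prod_univ_sum
    (fun v => (G.neighborFinset v).powersetCard (G.degree v / 2))
    fun v S => ∏ w ∈ G.neighborFinset v, (1 + (if w ∈ S then -1 else 1) * t s(v, w))]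
  refine Finset.prod_ne_zero_iff.2 fun v _ =>
    sum_powersetCard_prod_ne_zero _ (fun w => ht s(v, w)) ?_
  exact (Nat.div_le_self _ _).trans_eq (G.card_neighborFinset_eq_degree v).symm

theorem eval_subgraphPoly_vertexWeight_ne_zero (hG : ∀ v, Even (G.degree v)) {z : ℂ}
    (hz : ‖z‖ < 1) : (subgraphPoly (vertexWeight ℂ) G Finset.univ).eval z ≠ 0 := by
  have hsplit (s : V → Finset V) (t : Sym2 V → ℂ) (e : Sym2 V) :
      1 + Sym2.lift ⟨fun v w => dartSign ℂ s v w + dartSign ℂ s w v, fun _ _ => add_comm _ _⟩ e *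
        t e + dartProd (dartSign ℂ s) e * t e ^ 2 =
      dartProd (fun v w => 1 + dartSign ℂ s v w * t s(v, w)) e := by
    induction e using Sym2.ind with
    | _ v w =>
      simp only [dartProd_mk, Sym2.lift_mk, Sym2.eq_swap (a := w) (b := v)]
      ring
  have h := asano_contraction (halfChoices G)
    (fun e s => Sym2.lift ⟨fun v w => dartSign ℂ s v w + dartSign ℂ s w v,
      fun _ _ => add_comm _ _⟩ e) (fun e s => dartProd (dartSign ℂ s) e) G.edgeFinset (fun _ => 1)
    (fun t ht => by
      simpa only [one_mul, hsplit] using sum_halfChoices_prod_one_add_dartSign_ne_zero ht)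
    (z := -z) (by rwa [norm_neg])
  simp only [one_mul, sum_halfChoices_prod_one_add hG, neg_neg] at h
  exact right_ne_zero_of_mul h

omit [CharZero K] in
theorem one_le_eval_subgraphPoly_vertexWeight [LinearOrder K] [IsStrictOrderedRing K] {x : K}
    (hx : 0 ≤ x) : 1 ≤ (subgraphPoly (vertexWeight K) G Finset.univ).eval x :=
  one_le_eval_subgraphPoly_univ vertexWeight_nonneg (vertexWeight_zero_right K) hx

end HalfChoices

section Orientations

/-- A digraph on a finite vertex set is the same as a family of out-neighbourhoods. -/
noncomputable def digraphOfOutNeighbors (V : Type*) [Finite V] : (V → Finset V) ≃ Digraph V where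
  toFun s := ⟨fun v w => w ∈ s v⟩
  invFun D v := (Set.toFinite {w | D.Adj v w}).toFinset
  left_inv s := by ext; simp
  right_inv D := by ext; simp

theorem digraphOfOutNeighbors_adj {V : Type*} [Finite V] (s : V → Finset V) (v w : V) :
    (digraphOfOutNeighbors V s).Adj v w ↔ w ∈ s v := Iff.rfl

theorem dartProd_dartSign_eq_neg_one_iff {V : Type*} [DecidableEq V] (s : V → Finset V) (v w : V) :
    dartProd (dartSign ℝ s) s(v, w) = -1 ↔ Xor (w ∈ s v) (v ∈ s w) := by
  by_cases hv : w ∈ s v <;> by_cases hw : v ∈ s w <;>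
    norm_num [dartProd_mk, dartSign, xor_def, hv, hw]

theorem one_sub_dartProd_dartSign {V : Type*} [DecidableEq V] (s : V → Finset V) (e : Sym2 V) :
    1 - dartProd (dartSign ℝ s) e = if dartProd (dartSign ℝ s) e = -1 then 2 else 0 := by
  induction e using Sym2.ind with
  | _ v w =>
    by_cases hv : w ∈ s v <;> by_cases hw : v ∈ s w <;>
      norm_num [dartProd_mk, dartSign, hv, hw]

namespace FinGraph

variable {G : FinGraph.{u}}

theorem deg_eq_degree (v : G.V) [Fintype (G.graph.neighborSet v)] :
    G.deg v = G.graph.degree v := by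
  rw [deg]
  congr!

theorem IsOrientation.ncard_add_ncard {D : Digraph G.V} (hD : G.IsOrientation D) (v : G.V) :
    {w | D.Adj v w}.ncard + {w | D.Adj w v}.ncard = G.deg v := by
  classical
  have hdisj : Disjoint {w | D.Adj v w} {w | D.Adj w v} := Set.disjoint_left.2 fun w hvw hwv =>
    (xor_iff_or_and_not_and _ _).1 (hD.2 v w (hD.1 v w hvw)) |>.2 ⟨hvw, hwv⟩
  have hunion : {w | D.Adj v w} ∪ {w | D.Adj w v} = G.graph.neighborSet v :=
    Set.ext fun w => ⟨fun h => h.elim (hD.1 v w) fun h => (hD.1 w v h).symm,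
      fun h => (hD.2 v w h).or⟩
  rw [← Set.ncard_union_eq hdisj, hunion, Set.ncard_eq_toFinset_card', deg_eq_degree,
    ← G.graph.card_neighborFinset_eq_degree, SimpleGraph.neighborFinset]

variable [DecidableEq G.V] [DecidableRel G.graph.Adj]

theorem isOrientation_digraphOfOutNeighbors_iff (s : G.V → Finset G.V) :
    G.IsOrientation (digraphOfOutNeighbors G.V s) ↔
      (∀ v, s v ⊆ G.graph.neighborFinset v) ∧
        ∀ e ∈ G.graph.edgeFinset, dartProd (dartSign ℝ s) e = -1 := by
  simp only [IsOrientation, digraphOfOutNeighbors_adj, Sym2.forall,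
    dartProd_dartSign_eq_neg_one_iff, SimpleGraph.mem_edgeFinset, SimpleGraph.mem_edgeSet,
    Finset.subset_iff, SimpleGraph.mem_neighborFinset]

theorem isOrientation_and_isBalanced_iff (hG : G.IsEulerian) (s : G.V → Finset G.V) :
    G.IsOrientation (digraphOfOutNeighbors G.V s) ∧ IsBalanced (digraphOfOutNeighbors G.V s) ↔
      s ∈ halfChoices G.graph ∧
        ∀ e ∈ G.graph.edgeFinset, dartProd (dartSign ℝ s) e = -1 := by
  have hbalanced (h : G.IsOrientation (digraphOfOutNeighbors G.V s)) :
      IsBalanced (digraphOfOutNeighbors G.V s) ↔ ∀ v, (s v).card = G.graph.degree v / 2 := by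
    refine forall_congr' fun v => ?_
    have hsum := h.ncard_add_ncard v
    have hout : {w | (digraphOfOutNeighbors G.V s).Adj v w}.ncard = (s v).card :=
      Set.ncard_coe_finset (s v)
    have heven := hG v
    rw [deg_eq_degree] at hsum heven
    grind
  simp only [halfChoices, Fintype.mem_piFinset, Finset.mem_powersetCard, forall_and]
  rw [and_congr_right hbalanced, isOrientation_digraphOfOutNeighbors_iff]
  tauto

theorem numEulerianOrientations_eq_card (hG : G.IsEulerian) :
    G.numEulerianOrientations = ((halfChoices G.graph).filter fun s =>
      ∀ e ∈ G.graph.edgeFinset, dartProd (dartSign ℝ s) e = -1).card := by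
  rw [numEulerianOrientations, ← Set.ncard_preimage_of_injective_subset_range
    (digraphOfOutNeighbors G.V).injective (by simp), ← Set.ncard_coe_finset]
  congr 1
  ext s
  simpa using isOrientation_and_isBalanced_iff hG s

theorem two_pow_mul_numEulerianOrientations (hG : G.IsEulerian) :
    (2 : ℝ) ^ G.graph.edgeFinset.card * G.numEulerianOrientations =
      (halfChoices G.graph).card *
        (subgraphPoly (vertexWeight ℝ) G.graph Finset.univ).eval 1 := by
  have heven (v : G.V) : Even (G.graph.degree v) := deg_eq_degree v ▸ hG v
  have h := sum_halfChoices_prod_one_add heven (-1 : ℝ)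
  simp only [mul_neg_one, ← sub_eq_add_neg, neg_neg, one_sub_dartProd_dartSign,
    Finset.prod_ite_zero, Finset.prod_const] at h
  rw [← h, ← Finset.sum_filter, Finset.sum_const, nsmul_eq_mul, mul_comm,
    numEulerianOrientations_eq_card hG]

omit [DecidableEq G.V] [DecidableRel G.graph.Adj] in
theorem numEulerianOrientations_pos (hG : G.IsEulerian) : 0 < G.numEulerianOrientations := by
  classical
  have hpos : 0 < (2 : ℝ) ^ G.graph.edgeFinset.card * G.numEulerianOrientations := by
    rw [two_pow_mul_numEulerianOrientations hG]
    exact mul_pos (Nat.cast_pos.2 card_halfChoices_pos)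
      (one_pos.trans_le (one_le_eval_subgraphPoly_vertexWeight zero_le_one))
  exact_mod_cast pos_of_mul_pos_right hpos (by positivity)

theorem log_numEulerianOrientations (hG : G.IsEulerian) :
    Real.log G.numEulerianOrientations =
      ∑ v, (Real.log ((G.deg v).choose (G.deg v / 2)) - (G.deg v : ℝ) / 2 * Real.log 2) +
        Real.log ((subgraphPoly (vertexWeight ℝ) G.graph Finset.univ).eval 1) := by
  have heval : (subgraphPoly (vertexWeight ℝ) G.graph Finset.univ).eval 1 ≠ 0 :=
    (one_pos.trans_le (one_le_eval_subgraphPoly_vertexWeight zero_le_one)).ne'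
  have hchoices : ((halfChoices G.graph).card : ℝ) ≠ 0 :=
    Nat.cast_ne_zero.2 card_halfChoices_pos.ne'
  have hnum : (G.numEulerianOrientations : ℝ) ≠ 0 :=
    Nat.cast_ne_zero.2 (numEulerianOrientations_pos hG).ne'
  have hedges : ∑ v, (G.graph.degree v : ℝ) = 2 * G.graph.edgeFinset.card :=
    mod_cast G.graph.sum_degrees_eq_twice_card_edges
  have h := congrArg Real.log (two_pow_mul_numEulerianOrientations hG)
  rw [Real.log_mul (by positivity) hnum, Real.log_mul hchoices heval, card_halfChoices,
    Nat.cast_prod, Real.log_prod fun v _ => Nat.cast_ne_zero.2 (choose_half_pos _).ne',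
    Real.log_pow] at h
  simp only [deg_eq_degree]
  rw [Finset.sum_sub_distrib, ← Finset.sum_mul, ← Finset.sum_div, hedges]
  linear_combination h

end FinGraph

end Orientations

section Mobius

variable {V : Type*} {R : Type*} [CommRing R]

/-- The Möbius transform on the lattice of finite sets, evaluated at `S`. -/
def mobius (S : Finset V) : (Finset V → R) →ₗ[R] R :=
  ∑ T ∈ S.powerset, (-1 : R) ^ (S.card + T.card) • LinearMap.proj T

theorem mobius_apply (S : Finset V) (h : Finset V → R) :
    mobius S h = ∑ T ∈ S.powerset, (-1) ^ (S.card + T.card) * h T := by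
  simp [mobius, LinearMap.sum_apply]

theorem mobius_congr {S : Finset V} {g h : Finset V → R} (hgh : ∀ T ⊆ S, g T = h T) :
    mobius S g = mobius S h := by
  simp only [mobius_apply]
  exact Finset.sum_congr rfl fun T hT => by rw [hgh T (Finset.mem_powerset.1 hT)]

theorem mobius_insert [DecidableEq V] {v : V} {S : Finset V} (hv : v ∉ S) (h : Finset V → R) :
    mobius (insert v S) h = mobius S (fun T => h (insert v T)) - mobius S h := by
  simp only [mobius_apply, Finset.sum_powerset_insert hv]
  rw [add_comm, ← Finset.sum_sub_distrib, ← Finset.sum_add_distrib]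
  refine Finset.sum_congr rfl fun T hT => ?_
  rw [Finset.card_insert_of_notMem hv,
    Finset.card_insert_of_notMem fun h => hv (Finset.mem_powerset.1 hT h)]
  ring

theorem mobius_eq_zero_of_forall_insert_eq [DecidableEq V] {S : Finset V} {v : V} (hv : v ∈ S)
    {h : Finset V → R} (hh : ∀ T, h (insert v T) = h T) : mobius S h = 0 := by
  rw [← Finset.insert_erase hv, mobius_insert (Finset.notMem_erase v S), sub_eq_zero]
  exact mobius_congr fun T _ => hh T

theorem sum_powerset_mobius (h : Finset V → R) (U : Finset V) :
    ∑ S ∈ U.powerset, mobius S h = h U := by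
  classical
  induction U using Finset.induction_on generalizing h with
  | empty => simp [mobius_apply]
  | insert v U hv ih =>
    rw [Finset.sum_powerset_insert hv, ← Finset.sum_add_distrib, ← ih fun T => h (insert v T)]
    refine Finset.sum_congr rfl fun S hS => ?_
    rw [mobius_insert fun h => hv (Finset.mem_powerset.1 hS h), add_sub_cancel]

theorem mobius_eq_zero_of_additive [DecidableEq V] {A B : Finset V} (hd : Disjoint A B)
    (hA : A.Nonempty) (hB : B.Nonempty) {h : Finset V → R}
    (hadd : ∀ T ⊆ A ∪ B, h T = h (T ∩ A) + h (T ∩ B)) : mobius (A ∪ B) h = 0 := by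
  obtain ⟨a, ha⟩ := hA
  obtain ⟨b, hb⟩ := hB
  rw [mobius_congr hadd]
  change mobius (A ∪ B) ((fun T => h (T ∩ A)) + fun T => h (T ∩ B)) = 0
  rw [map_add, mobius_eq_zero_of_forall_insert_eq (Finset.mem_union_right A hb) fun T => ?_,
    mobius_eq_zero_of_forall_insert_eq (Finset.mem_union_left B ha) fun T => ?_, add_zero]
  · rw [Finset.insert_inter_of_notMem (Finset.disjoint_left.1 hd ha)]
  · rw [Finset.insert_inter_of_notMem (Finset.disjoint_right.1 hd hb)]

theorem powerset_map {W : Type*} (f : V ↪ W) (S : Finset V) :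
    (S.map f).powerset = S.powerset.map (Finset.mapEmbedding f).toEmbedding := by
  ext T
  simp [Finset.subset_map_iff, eq_comm]

theorem mobius_map {W : Type*} (f : V ↪ W) (h : Finset W → R) (S : Finset V) :
    mobius (S.map f) h = mobius S fun T => h (T.map f) := by
  simp [mobius_apply, powerset_map]

variable (V R) in
/-- The set functions of degree at most `m`, spanned by the indicators of containing a given set
of at most `m` elements. -/
def degreeLE (m : ℕ) : Submodule R (Finset V → R) :=
  Submodule.span R ((fun A => (Set.Ici A).indicator 1) '' {A | A.card ≤ m})

theorem indicator_Ici_mem_degreeLE {m : ℕ} {A : Finset V} (hA : A.card ≤ m) :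
    (Set.Ici A).indicator 1 ∈ degreeLE V R m :=
  Submodule.subset_span ⟨A, hA, rfl⟩

theorem degreeLE_mono {m n : ℕ} (h : m ≤ n) : degreeLE V R m ≤ degreeLE V R n :=
  Submodule.span_mono (Set.image_mono fun _ hA => le_trans hA h)

theorem mul_mem_degreeLE {m n : ℕ} {f g : Finset V → R} (hf : f ∈ degreeLE V R m)
    (hg : g ∈ degreeLE V R n) : f * g ∈ degreeLE V R (m + n) := by
  classical
  have h := Submodule.mul_mem_mul hf hg
  rw [degreeLE, degreeLE, Submodule.span_mul_span] at h
  refine Submodule.span_mono ?_ h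
  rintro _ ⟨_, ⟨A, hA, rfl⟩, _, ⟨B, hB, rfl⟩, rfl⟩
  refine ⟨A ∪ B, (Finset.card_union_le A B).trans (add_le_add hA hB), ?_⟩
  simp only [← Set.inter_indicator_one, Set.Ici_inter_Ici, Finset.sup_eq_union]

theorem mobius_eq_zero_of_mem_degreeLE {m : ℕ} {h : Finset V → R} (hh : h ∈ degreeLE V R m)
    {S : Finset V} (hS : m < S.card) : mobius S h = 0 := by
  classical
  rw [← LinearMap.mem_ker]
  refine Submodule.span_le.2 ?_ hh
  rintro _ ⟨A, hA, rfl⟩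
  obtain ⟨v, hvS, hvA⟩ := Finset.exists_mem_notMem_of_card_lt_card (hA.trans_lt hS)
  exact mobius_eq_zero_of_forall_insert_eq hvS fun T => by
    simp only [Set.indicator, Set.mem_Ici, Pi.one_apply, Finset.subset_insert_iff_of_notMem hvA]

end Mobius

section Multiplicativity

open Polynomial

theorem sum_powerset_union {α M : Type*} [DecidableEq α] [AddCommMonoid M] {A B : Finset α}
    (h : Disjoint A B) (g : Finset α → M) :
    ∑ C ∈ (A ∪ B).powerset, g C = ∑ C ∈ A.powerset, ∑ D ∈ B.powerset, g (C ∪ D) := by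
  induction B using Finset.induction_on generalizing g with
  | empty => simp
  | insert b B hb ih =>
    rw [Finset.disjoint_insert_right] at h
    simp only [Finset.union_insert, Finset.sum_powerset_insert hb, Finset.sum_add_distrib]
    rw [Finset.sum_powerset_insert (by simp [h.1, hb]), ih h.2, ih h.2]

variable {V : Type*} [DecidableEq V]

theorem incCount_union {A B : Finset (Sym2 V)} (h : Disjoint A B) (v : V) :
    incCount (A ∪ B) v = incCount A v + incCount B v := by
  rw [incCount, Finset.filter_union,
    Finset.card_union_of_disjoint (Finset.disjoint_filter_filter h), incCount, incCount]

theorem incCount_eq_zero_iff {A : Finset (Sym2 V)} {v : V} :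
    incCount A v = 0 ↔ ∀ e ∈ A, v ∉ e := by
  rw [incCount, Finset.card_eq_zero, Finset.filter_eq_empty_iff]

variable [Fintype V] {R : Type*} [CommRing R] {w : ℕ → ℕ → R} {G : SimpleGraph V}
  [DecidableRel G.Adj]

theorem subset_edgesIn_iff {S : Finset V} {A : Finset (Sym2 V)} :
    A ⊆ edgesIn G S ↔ A ⊆ G.edgeFinset ∧ A.biUnion Sym2.toFinset ⊆ S := by
  rw [Finset.biUnion_subset]
  simp only [edgesIn, Finset.subset_iff, Finset.mem_filter, Sym2.mem_toFinset, imp_and, forall_and]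

theorem incCount_eq_zero_of_subset_edgesIn {S : Finset V} {A : Finset (Sym2 V)}
    (hA : A ⊆ edgesIn G S) {v : V} (hv : v ∉ S) : incCount A v = 0 :=
  incCount_eq_zero_iff.2 fun _ he hve => hv ((Finset.mem_filter.1 (hA he)).2 v hve)

theorem disjoint_edgesIn {S T : Finset V} (h : Disjoint S T) :
    Disjoint (edgesIn G S) (edgesIn G T) :=
  Finset.disjoint_left.2 fun e he he' =>
    Finset.disjoint_left.1 h ((Finset.mem_filter.1 he).2 _ e.out_fst_mem)
      ((Finset.mem_filter.1 he').2 _ e.out_fst_mem)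

theorem edgeWeight_union (hw : ∀ d, w d 0 = 1) {S T : Finset V} (h : Disjoint S T)
    {A B : Finset (Sym2 V)} (hA : A ⊆ edgesIn G S) (hB : B ⊆ edgesIn G T) :
    edgeWeight w G (A ∪ B) = edgeWeight w G A * edgeWeight w G B := by
  simp only [edgeWeight, ← Finset.prod_mul_distrib,
    incCount_union ((disjoint_edgesIn h).mono hA hB)]
  refine Finset.prod_congr rfl fun v _ => ?_
  by_cases hv : v ∈ S
  · rw [incCount_eq_zero_of_subset_edgesIn hB (Finset.disjoint_left.1 h hv), hw, add_zero, mul_one]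
  · rw [incCount_eq_zero_of_subset_edgesIn hA hv, hw, zero_add, one_mul]

theorem edgesIn_union {S T : Finset V} (hST : ∀ a ∈ S, ∀ b ∈ T, ¬ G.Adj a b) :
    edgesIn G (S ∪ T) = edgesIn G S ∪ edgesIn G T := by
  ext e
  induction e using Sym2.ind with
  | _ a b =>
    simp only [edgesIn, Finset.mem_filter, Finset.mem_union, SimpleGraph.mem_edgeFinset,
      SimpleGraph.mem_edgeSet, Sym2.mem_iff, forall_eq_or_imp, forall_eq]
    grind [G.adj_comm a b]

theorem subgraphPoly_union (hw : ∀ d, w d 0 = 1) {S T : Finset V} (h : Disjoint S T)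
    (hST : ∀ a ∈ S, ∀ b ∈ T, ¬ G.Adj a b) :
    subgraphPoly w G (S ∪ T) = subgraphPoly w G S * subgraphPoly w G T := by
  rw [subgraphPoly, edgesIn_union hST, sum_powerset_union (disjoint_edgesIn h), subgraphPoly,
    subgraphPoly, Finset.sum_mul_sum]
  refine Finset.sum_congr rfl fun A hA => Finset.sum_congr rfl fun B hB => ?_
  rw [Finset.mem_powerset] at hA hB
  rw [edgeWeight_union hw h hA hB,
    Finset.card_union_of_disjoint ((disjoint_edgesIn h).mono hA hB), C_mul, pow_add]
  ring

theorem subgraphPoly_empty (hw : ∀ d, w d 0 = 1) : subgraphPoly w G ∅ = 1 := by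
  have hedges : edgesIn G ∅ = ∅ :=
    Finset.filter_eq_empty_iff.2 fun e _ he => Finset.notMem_empty _ (he _ e.out_fst_mem)
  simp [subgraphPoly, hedges, edgeWeight_empty hw]

theorem coeff_subgraphPoly_mem_degreeLE (j : ℕ) :
    (fun S => (subgraphPoly w G S).coeff j) ∈ degreeLE V R (2 * j) := by
  have hindicator : (fun S => (subgraphPoly w G S).coeff j) =
      ∑ A ∈ G.edgeFinset.powersetCard j,
        edgeWeight w G A • (Set.Ici (A.biUnion Sym2.toFinset)).indicator 1 := by
    funext S
    simp only [coeff_subgraphPoly, Finset.sum_apply, Pi.smul_apply, Set.indicator, Set.mem_Ici,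
      Pi.one_apply, smul_eq_mul, mul_ite, mul_one, mul_zero, ← Finset.sum_filter]
    refine Finset.sum_congr (Finset.ext fun A => ?_) fun _ _ => rfl
    simp only [Finset.mem_powersetCard, Finset.mem_filter, subset_edgesIn_iff]
    exact and_right_comm
  rw [hindicator]
  refine Submodule.sum_mem _ fun A hA => Submodule.smul_mem _ _ (indicator_Ici_mem_degreeLE ?_)
  rw [← (Finset.mem_powersetCard.1 hA).2, mul_comm]
  refine Finset.card_biUnion_le_card_mul _ _ 2 fun e _ => ?_
  rw [Sym2.card_toFinset]
  split_ifs <;> norm_num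

end Multiplicativity

section Cumulants

open Polynomial

variable {V : Type*} [DecidableEq V] [Fintype V] {K : Type*} [Field K] (w : ℕ → ℕ → K)
  (G : SimpleGraph V) [DecidableRel G.Adj]

/-- The contribution of the vertex set `S` to the coefficient of degree `k` of the logarithmic
derivative of the generating polynomial of `G`. -/
noncomputable def cumulant (k : ℕ) (S : Finset V) : K :=
  mobius S fun T => logCoeff (subgraphPoly w G T) k

/-- The share of a vertex in the coefficient of degree `k` of the logarithmic derivative of the
generating polynomial, where every cumulant is split evenly among the vertices of its set. -/
noncomputable def vertexShare (k : ℕ) (v : V) : K :=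
  ∑ S : Finset V with v ∈ S, cumulant w G k S / S.card

variable {w G}

theorem logCoeff_subgraphPoly_mem_degreeLE (hw : ∀ d, w d 0 = 1) (k : ℕ) :
    (fun S => logCoeff (subgraphPoly w G S) k) ∈ degreeLE V K (2 * k + 2) := by
  induction k using Nat.strong_induction_on with
  | _ k ih =>
    have hrec : (fun S => logCoeff (subgraphPoly w G S) k) =
        ((k : K) + 1) • (fun S => (subgraphPoly w G S).coeff (k + 1)) -
          ∑ i ∈ Finset.range k, (fun S => logCoeff (subgraphPoly w G S) i) *
            fun S => (subgraphPoly w G S).coeff (k - i) := by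
      funext S
      rw [logCoeff_recursion (coeff_zero_subgraphPoly hw S)]
      simp [Finset.sum_apply]
    rw [hrec]
    refine Submodule.sub_mem _ (Submodule.smul_mem _ _ (coeff_subgraphPoly_mem_degreeLE (k + 1)))
      (Submodule.sum_mem _ fun i hi => ?_)
    rw [Finset.mem_range] at hi
    exact degreeLE_mono (by lia)
      (mul_mem_degreeLE (ih i hi) (coeff_subgraphPoly_mem_degreeLE (k - i)))

theorem cumulant_eq_zero_of_lt_card (hw : ∀ d, w d 0 = 1) {k : ℕ} {S : Finset V}
    (hS : 2 * k + 2 < S.card) : cumulant w G k S = 0 :=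
  mobius_eq_zero_of_mem_degreeLE (logCoeff_subgraphPoly_mem_degreeLE hw k) hS

theorem cumulant_empty (hw : ∀ d, w d 0 = 1) (k : ℕ) : cumulant w G k ∅ = 0 := by
  simp [cumulant, mobius_apply, subgraphPoly_empty hw, logCoeff_one]

theorem cumulant_union_eq_zero (hw : ∀ d, w d 0 = 1) {A B : Finset V} (hd : Disjoint A B)
    (hA : A.Nonempty) (hB : B.Nonempty) (hAB : ∀ a ∈ A, ∀ b ∈ B, ¬ G.Adj a b) (k : ℕ) :
    cumulant w G k (A ∪ B) = 0 := by
  refine mobius_eq_zero_of_additive hd hA hB fun T hT => ?_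
  rw [← logCoeff_mul (coeff_zero_subgraphPoly hw _) (coeff_zero_subgraphPoly hw _),
    ← subgraphPoly_union hw, ← Finset.inter_union_distrib_left, Finset.inter_eq_left.2 hT]
  · exact hd.mono Finset.inter_subset_right Finset.inter_subset_right
  · exact fun a ha b hb => hAB a (Finset.mem_inter.1 ha).2 b (Finset.mem_inter.1 hb).2

theorem preconnected_induce_of_cumulant_ne_zero (hw : ∀ d, w d 0 = 1) {k : ℕ} {S : Finset V}
    (hS : cumulant w G k S ≠ 0) : (G.induce (S : Set V)).Preconnected := by
  classical
  by_contra hcon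
  obtain ⟨a, b, hab⟩ : ∃ a b, ¬ (G.induce (S : Set V)).Reachable a b := by
    simpa [SimpleGraph.Preconnected] using hcon
  let reached (x : V) : Prop := ∃ hx : x ∈ S, (G.induce (S : Set V)).Reachable a ⟨x, hx⟩
  refine hS ?_
  rw [← Finset.filter_union_filter_not_eq reached S]
  refine cumulant_union_eq_zero hw (Finset.disjoint_filter_filter_not S S reached)
    ⟨a, ?_⟩ ⟨b, ?_⟩ ?_ k
  · exact Finset.mem_filter.2 ⟨a.2, a.2, .rfl⟩
  · exact Finset.mem_filter.2 ⟨b.2, fun ⟨_, h⟩ => hab h⟩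
  · intro x hx y hy hxy
    obtain ⟨_, hxS, hax⟩ := Finset.mem_filter.1 hx
    obtain ⟨hyS, hay⟩ := Finset.mem_filter.1 hy
    have hadj : (G.induce (S : Set V)).Adj ⟨x, hxS⟩ ⟨y, hyS⟩ := hxy
    exact hay ⟨hyS, hax.trans hadj.reachable⟩

theorem edist_lt_of_cumulant_ne_zero (hw : ∀ d, w d 0 = 1) {k : ℕ} {S : Finset V}
    (hS : cumulant w G k S ≠ 0) {u v : V} (hu : u ∈ S) (hv : v ∈ S) :
    G.edist u v < (2 * k + 2 : ℕ) := by
  obtain ⟨p, hp⟩ :=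
    (preconnected_induce_of_cumulant_ne_zero hw hS ⟨u, hu⟩ ⟨v, hv⟩).exists_isPath
  have hlength : p.length < 2 * k + 2 := hp.length_lt.trans_le <| by
    simpa using le_of_not_gt fun h => hS (cumulant_eq_zero_of_lt_card hw h)
  have hle := (p.map (SimpleGraph.Embedding.induce _).toHom).edist_le
  rw [SimpleGraph.Walk.length_map] at hle
  exact hle.trans_lt (by exact_mod_cast hlength)

theorem sum_vertexShare [CharZero K] (hw : ∀ d, w d 0 = 1) (k : ℕ) :
    ∑ v, vertexShare w G k v = logCoeff (subgraphPoly w G Finset.univ) k := by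
  rw [← sum_powerset_mobius (fun T => logCoeff (subgraphPoly w G T) k), Finset.powerset_univ]
  simp only [vertexShare, Finset.sum_filter]
  rw [Finset.sum_comm]
  refine Finset.sum_congr rfl fun S _ => ?_
  rw [← Finset.sum_filter, Finset.filter_mem_eq_inter, Finset.univ_inter, Finset.sum_const,
    nsmul_eq_mul]
  rcases S.eq_empty_or_nonempty with rfl | hS
  · rw [cumulant_empty hw, zero_div, mul_zero]
    exact (cumulant_empty hw k).symm
  · exact mul_div_cancel₀ _ (Nat.cast_ne_zero.2 hS.card_pos.ne')

theorem vertexShare_eq_sum_powerset (hw : ∀ d, w d 0 = 1) {k : ℕ} {v : V} {B : Finset V}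
    (hB : ∀ u, G.edist v u < (2 * k + 2 : ℕ) → u ∈ B) :
    vertexShare w G k v = ∑ S ∈ B.powerset with v ∈ S, cumulant w G k S / S.card := by
  refine (Finset.sum_subset (Finset.filter_subset_filter _ (Finset.subset_univ _))
    fun S hS hSB => ?_).symm
  simp only [Finset.mem_filter, Finset.mem_powerset, Finset.mem_univ, true_and] at hS hSB
  have hzero : cumulant w G k S = 0 := by
    by_contra hne
    exact hSB ⟨fun u hu => hB u (edist_lt_of_cumulant_ne_zero hw hne hS hu), hS⟩
  rw [hzero, zero_div]

end Cumulants

section LocalIsomorphisms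

variable {V W : Type*} {G : SimpleGraph V} {H : SimpleGraph W}

theorem edist_map_le (f : G ↪g H) (a b : V) : H.edist (f a) (f b) ≤ G.edist a b :=
  le_iInf fun p => (p.map f.toHom).edist_le.trans_eq (by rw [SimpleGraph.Walk.length_map])

variable [Fintype V] [DecidableEq V] [DecidableRel G.Adj]
  [Fintype W] [DecidableEq W] [DecidableRel H.Adj]

/-- An embedding of graphs that maps the ball of radius `r` around `v` onto the ball of radius `r`
around `f v`, and preserves the degrees of its vertices. -/
def IsLocalIso (f : G ↪g H) (v : V) (r : ℕ) : Prop :=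
  (∀ a, G.edist v a ≤ r → H.degree (f a) = G.degree a) ∧
    ∀ b, H.edist (f v) b ≤ r → ∃ a, f a = b ∧ G.edist v a ≤ r

theorem edgesIn_map (f : G ↪g H) (S : Finset V) :
    edgesIn H (S.map f.toEmbedding) = (edgesIn G S).map f.toEmbedding.sym2Map := by
  ext e
  induction e using Sym2.ind with
  | _ a b =>
    simp only [edgesIn, Finset.mem_filter, SimpleGraph.mem_edgeFinset, SimpleGraph.mem_edgeSet,
      Sym2.mem_iff, forall_eq_or_imp, forall_eq, Finset.mem_map]
    constructor
    · rintro ⟨hab, ⟨x, hx, rfl⟩, ⟨y, hy, rfl⟩⟩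
      refine ⟨s(x, y), ⟨f.map_adj_iff.1 hab, fun v hv => ?_⟩, rfl⟩
      rcases Sym2.mem_iff.1 hv with rfl | rfl <;> assumption
    · rintro ⟨e, ⟨he, hS⟩, hab⟩
      induction e using Sym2.ind with
      | _ x y =>
        have hx := hS x (Sym2.mem_mk_left x y)
        have hy := hS y (Sym2.mem_mk_right x y)
        have hxy : H.Adj (f x) (f y) := f.map_adj_iff.2 he
        rcases Sym2.eq_iff.1 (hab : s(f x, f y) = s(a, b)) with ⟨rfl, rfl⟩ | ⟨rfl, rfl⟩
        · exact ⟨hxy, ⟨x, hx, rfl⟩, ⟨y, hy, rfl⟩⟩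
        · exact ⟨hxy.symm, ⟨y, hy, rfl⟩, ⟨x, hx, rfl⟩⟩

omit [Fintype V] [Fintype W] in
theorem incCount_map (f : V ↪ W) (A : Finset (Sym2 V)) (v : V) :
    incCount (A.map f.sym2Map) (f v) = incCount A v := by
  rw [incCount, Finset.filter_map, Finset.card_map, incCount]
  congr 1
  refine Finset.filter_congr fun e _ => ?_
  simp

variable {R : Type*} [CommRing R] {w : ℕ → ℕ → R}

theorem edgeWeight_map (hw : ∀ d, w d 0 = 1) (f : G ↪g H) {S : Finset V}
    (hdeg : ∀ a ∈ S, H.degree (f a) = G.degree a) {A : Finset (Sym2 V)} (hA : A ⊆ edgesIn G S) :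
    edgeWeight w H (A.map f.toEmbedding.sym2Map) = edgeWeight w G A := by
  rw [edgeWeight, edgeWeight,
    ← Finset.prod_subset (Finset.subset_univ (Finset.univ.map f.toEmbedding)), Finset.prod_map]
  · refine Finset.prod_congr rfl fun v _ => ?_
    rw [incCount_map]
    by_cases hv : v ∈ S
    · rw [← hdeg v hv]; rfl
    · rw [incCount_eq_zero_of_subset_edgesIn hA hv, hw, hw]
  · intro b _ hb
    have hzero : incCount (A.map f.toEmbedding.sym2Map) b = 0 :=
      incCount_eq_zero_iff.2 fun e he hbe => by
        obtain ⟨e', -, rfl⟩ := Finset.mem_map.1 he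
        obtain ⟨a, -, rfl⟩ := Sym2.mem_map.1 hbe
        exact hb (Finset.mem_map_of_mem _ (Finset.mem_univ a))
    rw [hzero, hw]

theorem subgraphPoly_map (hw : ∀ d, w d 0 = 1) (f : G ↪g H) {S : Finset V}
    (hdeg : ∀ a ∈ S, H.degree (f a) = G.degree a) :
    subgraphPoly w H (S.map f.toEmbedding) = subgraphPoly w G S := by
  ext j
  rw [coeff_subgraphPoly, coeff_subgraphPoly, edgesIn_map, Finset.powersetCard_map, Finset.sum_map]
  exact Finset.sum_congr rfl fun A hA =>
    edgeWeight_map hw f hdeg (Finset.mem_powersetCard.1 hA).1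

variable {K : Type*} [Field K] {w : ℕ → ℕ → K}

theorem cumulant_map (hw : ∀ d, w d 0 = 1) (f : G ↪g H) {S : Finset V}
    (hdeg : ∀ a ∈ S, H.degree (f a) = G.degree a) (k : ℕ) :
    cumulant w H k (S.map f.toEmbedding) = cumulant w G k S := by
  rw [cumulant, mobius_map]
  exact mobius_congr fun T hT => by rw [subgraphPoly_map hw f fun a ha => hdeg a (hT ha)]

theorem vertexShare_eq_of_isLocalIso (hw : ∀ d, w d 0 = 1) {f : G ↪g H} {v : V} {k r : ℕ}
    (hf : IsLocalIso f v r) (hk : 2 * k + 2 ≤ r) :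
    vertexShare w H k (f v) = vertexShare w G k v := by
  classical
  have hkr : ((2 * k + 2 : ℕ) : ℕ∞) ≤ r := by exact_mod_cast hk
  set B : Finset V := Finset.univ.filter fun a => G.edist v a ≤ r
  have hB (a : V) : a ∈ B ↔ G.edist v a ≤ r := by simp [B]
  rw [vertexShare_eq_sum_powerset hw (B := B) fun a ha => (hB a).2 (ha.le.trans hkr),
    vertexShare_eq_sum_powerset hw (B := B.map f.toEmbedding) fun b hb => ?_]
  · rw [powerset_map, Finset.filter_map, Finset.sum_map]
    refine Finset.sum_congr (by ext; simp) fun S hS => ?_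
    have hSB := Finset.mem_powerset.1 (Finset.mem_filter.1 hS).1
    simp [cumulant_map hw f fun a ha => hf.1 a ((hB a).1 (hSB ha))]
  · obtain ⟨a, rfl, ha⟩ := hf.2 b (hb.le.trans hkr)
    exact Finset.mem_map_of_mem _ ((hB a).2 ha)

end LocalIsomorphisms

section LocalEntropy

open Polynomial

variable {V W : Type*} [Fintype V] [DecidableEq V] (G : SimpleGraph V) [DecidableRel G.Adj]
  [Fintype W] [DecidableEq W] {H : SimpleGraph W} [DecidableRel H.Adj]

/-- The share of the vertex `v` in the logarithm of the number of Eulerian orientations, where the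
logarithm of the generating polynomial at `1` is replaced by its Taylor polynomial of degree `K`
at `x`. -/
noncomputable def localEntropy (x : ℝ) (K : ℕ) (v : V) : ℝ :=
  Real.log ((G.degree v).choose (G.degree v / 2)) - (G.degree v : ℝ) / 2 * Real.log 2 +
    ∑ k ∈ Finset.range K, vertexShare (vertexWeight ℝ) G k v * x ^ (k + 1) / (k + 1)

theorem sum_localEntropy (x : ℝ) (K : ℕ) :
    ∑ v, localEntropy G x K v =
      ∑ v, (Real.log ((G.degree v).choose (G.degree v / 2)) -
        (G.degree v : ℝ) / 2 * Real.log 2) +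
      ∑ k ∈ Finset.range K,
        logCoeff (subgraphPoly (vertexWeight ℝ) G Finset.univ) k * x ^ (k + 1) / (k + 1) := by
  simp only [localEntropy, Finset.sum_add_distrib, add_right_inj]
  rw [Finset.sum_comm]
  refine Finset.sum_congr rfl fun k _ => ?_
  rw [← sum_vertexShare (vertexWeight_zero_right ℝ), Finset.sum_mul, Finset.sum_div]

variable {G}

theorem localEntropy_eq_of_isLocalIso {f : G ↪g H} {v : V} {x : ℝ} {K : ℕ}
    (hf : IsLocalIso f v (2 * K)) : localEntropy H x K (f v) = localEntropy G x K v := by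
  rw [localEntropy, localEntropy, hf.1 v (by simp)]
  congr 1
  refine Finset.sum_congr rfl fun k hk => ?_
  rw [vertexShare_eq_of_isLocalIso (vertexWeight_zero_right ℝ) hf
    (by have := Finset.mem_range.1 hk; lia)]

omit [DecidableEq V] [DecidableEq W] in
theorem isLocalIso_of_iso (e : G ≃g H) (v : V) (r : ℕ) : IsLocalIso e.toEmbedding v r := by
  refine ⟨fun a _ => e.degree_eq a, fun b hb => ⟨e.symm b, e.apply_symm_apply b, ?_⟩⟩
  simpa using (edist_map_le e.symm.toEmbedding (e v) b).trans hb

theorem abs_log_eval_one_sub_log_eval_subgraphPoly_le {w : ℕ → ℕ → ℝ} (hw : ∀ d k, 0 ≤ w d k)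
    (hw0 : ∀ d, w d 0 = 1) {x : ℝ} (hx0 : 0 < x) (hx1 : x ≤ 1) :
    |Real.log ((subgraphPoly w G Finset.univ).eval 1) -
      Real.log ((subgraphPoly w G Finset.univ).eval x)| ≤
      G.edgeFinset.card * -Real.log x := by
  have hpos {y : ℝ} (hy : 0 ≤ y) : 0 < (subgraphPoly w G Finset.univ).eval y :=
    one_pos.trans_le (one_le_eval_subgraphPoly_univ hw hw0 hy)
  have hle := Real.log_le_log (hpos hx0.le) (eval_subgraphPoly_univ_mono hw hx0.le hx1)
  have hge := Real.log_le_log (mul_pos (pow_pos hx0 _) (hpos zero_le_one))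
    (pow_mul_eval_one_subgraphPoly_univ_le hw hx0.le hx1)
  rw [Real.log_mul (by positivity) (hpos zero_le_one).ne', Real.log_pow] at hge
  rw [abs_of_nonneg (sub_nonneg.2 hle)]
  linarith

theorem aeval_subgraphPoly_vertexWeight_ne_zero (hG : ∀ v, Even (G.degree v)) {z : ℂ}
    (hz : ‖z‖ < 1) : aeval z (subgraphPoly (vertexWeight ℝ) G Finset.univ) ≠ 0 := by
  rw [← eval_map_algebraMap, map_subgraphPoly]
  simpa only [map_vertexWeight] using eval_subgraphPoly_vertexWeight_ne_zero hG hz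

theorem abs_log_eval_one_subgraphPoly_sub_le (hG : ∀ v, Even (G.degree v)) {x : ℝ}
    (hx0 : 0 < x) (hx1 : x < 1) (K : ℕ) :
    |Real.log ((subgraphPoly (vertexWeight ℝ) G Finset.univ).eval 1) -
      ∑ k ∈ Finset.range K,
        logCoeff (subgraphPoly (vertexWeight ℝ) G Finset.univ) k * x ^ (k + 1) / (k + 1)| ≤
      G.edgeFinset.card * (-Real.log x + x ^ (K + 1) / (1 - x)) := by
  have hshift := abs_log_eval_one_sub_log_eval_subgraphPoly_le (G := G) vertexWeight_nonneg
    (vertexWeight_zero_right ℝ) hx0 hx1.le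
  have htaylor := abs_log_eval_sub_sum_logCoeff_le
    (coeff_zero_subgraphPoly (G := G) (vertexWeight_zero_right ℝ) Finset.univ)
    (fun z hz => aeval_subgraphPoly_vertexWeight_ne_zero hG hz) (by rwa [abs_of_pos hx0]) K
  rw [abs_of_pos hx0] at htaylor
  have hdegree : ((subgraphPoly (vertexWeight ℝ) G Finset.univ).natDegree : ℝ) *
      (x ^ (K + 1) / (1 - x)) ≤ G.edgeFinset.card * (x ^ (K + 1) / (1 - x)) :=
    mul_le_mul_of_nonneg_right (Nat.cast_le.2 natDegree_subgraphPoly_univ_le)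
      (div_nonneg (by positivity) (sub_nonneg.2 hx1.le))
  rw [mul_add]
  exact (abs_sub_le _ _ _).trans (add_le_add hshift (htaylor.trans hdegree))

theorem exists_neg_log_add_pow_div_le {ε : ℝ} (hε : 0 < ε) :
    ∃ x : ℝ, 0 < x ∧ x < 1 ∧ ∃ K : ℕ, -Real.log x + x ^ (K + 1) / (1 - x) ≤ ε := by
  have hlt : Real.exp (-(ε / 2)) < 1 := Real.exp_lt_one_iff.2 (by linarith)
  have hsub : 0 < 1 - Real.exp (-(ε / 2)) := sub_pos.2 hlt
  obtain ⟨K, hK⟩ := exists_pow_lt_of_lt_one (mul_pos (half_pos hε) hsub) hlt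
  refine ⟨_, Real.exp_pos _, hlt, K, ?_⟩
  have htail : Real.exp (-(ε / 2)) ^ (K + 1) / (1 - Real.exp (-(ε / 2))) ≤ ε / 2 :=
    (div_le_iff₀ hsub).2
      ((pow_le_pow_of_le_one (Real.exp_pos _).le hlt.le K.le_succ).trans hK.le)
  rw [Real.log_exp]
  linarith

end LocalEntropy

section Neighbourhoods

namespace RootedGraph

open Classical in
/-- The local entropy at the root. -/
noncomputable def rootEntropy (A : RootedGraph.{u}) (x : ℝ) (K : ℕ) : ℝ :=
  letI := Fintype.ofFinite A.V
  localEntropy A.graph x K A.root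

theorem IsIso.rootEntropy_eq {A B : RootedGraph.{u}} (h : A.IsIso B) (x : ℝ) (K : ℕ) :
    A.rootEntropy x K = B.rootEntropy x K := by
  classical
  obtain ⟨e, he⟩ := h
  let _ := Fintype.ofFinite A.V
  let _ := Fintype.ofFinite B.V
  rw [rootEntropy, rootEntropy, ← he]
  exact (localEntropy_eq_of_isLocalIso (isLocalIso_of_iso e A.root (2 * K))).symm

end RootedGraph

/-- The local entropy at the root, as a function of isomorphism classes of rooted graphs. -/
noncomputable def neighbourhoodEntropy (x : ℝ) (K r : ℕ) : Neighbourhood.{u} r → ℝ :=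
  Quotient.lift (fun A => A.1.rootEntropy x K) fun _ _ h => RootedGraph.IsIso.rootEntropy_eq h x K

namespace FinGraph

theorem ballSet_mono (G : FinGraph.{u}) (v : G.V) {r s : ℕ} (h : r ≤ s) :
    G.ballSet v r ⊆ G.ballSet v s :=
  fun w hw => (show G.graph.edist v w ≤ r from hw).trans (Nat.cast_le.2 h)

theorem mem_ballSet_succ_of_adj {G : FinGraph.{u}} {v a b : G.V} {r : ℕ} (ha : a ∈ G.ballSet v r)
    (hab : G.graph.Adj a b) : b ∈ G.ballSet v (r + 1) :=
  SimpleGraph.edist_triangle.trans <| by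
    rw [SimpleGraph.edist_eq_one_iff_adj.2 hab, Nat.cast_succ]
    exact add_le_add_left ha 1

theorem isLocalIso_ball (G : FinGraph.{u}) (v : G.V) (r : ℕ) [DecidableRel G.graph.Adj]
    [Fintype (G.ballSet v (r + 1))] :
    IsLocalIso (SimpleGraph.Embedding.induce (G := G.graph) (G.ballSet v (r + 1)))
      ⟨v, G.self_mem_ballSet v (r + 1)⟩ r := by
  classical
  refine ⟨fun a ha => ?_, fun b hb => ?_⟩
  · have ha' : (a : G.V) ∈ G.ballSet v r := (edist_map_le (.induce _) _ a).trans ha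
    have hdeg := SimpleGraph.degree_induce_of_neighborSet_subset (G := G.graph) (v := a)
      fun b hab => mem_ballSet_succ_of_adj ha' hab
    convert hdeg.symm
    rfl
  · have hsub := G.ballSet_mono v r.le_succ
    obtain ⟨p, hp⟩ := G.exists_walk_ball v r ⟨b, hb⟩
    refine ⟨⟨b, hsub hb⟩, rfl, ?_⟩
    refine (p.map (G.graph.induceHomOfLE hsub).toHom).edist_le.trans ?_
    rw [SimpleGraph.Walk.length_map]
    exact Nat.cast_le.2 hp

theorem neighbourhoodEntropy_neighbourhood (G : FinGraph.{u}) [DecidableEq G.V]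
    [DecidableRel G.graph.Adj] (x : ℝ) (K : ℕ) (v : G.V) :
    neighbourhoodEntropy x K (2 * K + 1) (G.neighbourhood (2 * K + 1) v) =
      localEntropy G.graph x K v := by
  classical
  let _ : Fintype (G.ballSet v (2 * K + 1)) := Fintype.ofFinite (G.ball v (2 * K + 1)).V
  have h := localEntropy_eq_of_isLocalIso (x := x) (G.isLocalIso_ball v (2 * K))
  refine Eq.trans ?_ h.symm
  change RootedGraph.rootEntropy (G.ball v (2 * K + 1)) x K = _
  rw [RootedGraph.rootEntropy]
  congr!

theorem order_eq_card (G : FinGraph.{u}) : G.order = Fintype.card G.V := Nat.card_eq_fintype_card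

theorem order_pos (G : FinGraph.{u}) : 0 < G.order := Nat.card_pos

theorem card_edgeFinset_le {G : FinGraph.{u}} [DecidableRel G.graph.Adj] {Δ : ℕ}
    (hΔ : G.MaxDegLE Δ) : G.graph.edgeFinset.card ≤ Δ * G.order := by
  have hsum : ∑ v, G.graph.degree v ≤ Fintype.card G.V * Δ :=
    Finset.sum_le_card_nsmul _ _ _ fun v _ => (deg_eq_degree v).symm.trans_le (hΔ v)
  rw [G.graph.sum_degrees_eq_twice_card_edges] at hsum
  rw [order_eq_card]
  lia

theorem abs_log_sub_sum_localEntropy_le {G : FinGraph.{u}} [DecidableEq G.V]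
    [DecidableRel G.graph.Adj] (hG : G.IsEulerian) {x : ℝ} (hx0 : 0 < x) (hx1 : x < 1) (K : ℕ) :
    |Real.log G.numEulerianOrientations - ∑ v, localEntropy G.graph x K v| ≤
      G.graph.edgeFinset.card * (-Real.log x + x ^ (K + 1) / (1 - x)) := by
  rw [log_numEulerianOrientations hG, sum_localEntropy]
  simp only [deg_eq_degree, add_sub_add_left_eq_sub]
  exact abs_log_eval_one_subgraphPoly_sub_le
    (fun v => by simpa only [deg_eq_degree] using hG v) hx0 hx1 K

end FinGraph

/-- The graph parameter `f` is, uniformly on `C` and up to an arbitrarily small error, the average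
over the vertices of a function of their neighbourhoods. -/
def IsLocallyApproximableOn (C : Set FinGraph.{u}) (f : FinGraph.{u} → ℝ) : Prop :=
  ∀ ε : ℝ, 0 < ε → ∃ r : ℕ, 0 < r ∧ ∃ ψ : Neighbourhood.{u} r → ℝ, ∀ G ∈ C,
    |f G - (∑ v, ψ (G.neighbourhood r v)) / G.order| ≤ ε

theorem isLocallyApproximableOn_entropy (Δ : ℕ) :
    IsLocallyApproximableOn {G : FinGraph.{u} | G.IsEulerian ∧ G.MaxDegLE Δ}
      FinGraph.entropy := by
  classical
  intro ε hε
  obtain ⟨x, hx0, hx1, K, hK⟩ := exists_neg_log_add_pow_div_le (ε := ε / (Δ + 1)) (by positivity)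
  refine ⟨2 * K + 1, by lia, neighbourhoodEntropy x K (2 * K + 1), fun G ⟨hG, hΔ⟩ => ?_⟩
  simp only [G.neighbourhoodEntropy_neighbourhood]
  have hn : (0 : ℝ) < G.order := Nat.cast_pos.2 G.order_pos
  have hedges : (G.graph.edgeFinset.card : ℝ) ≤ (Δ + 1) * G.order := by
    refine (Nat.cast_le.2 (FinGraph.card_edgeFinset_le hΔ)).trans ?_
    push_cast
    gcongr
    linarith
  rw [FinGraph.entropy, one_div_mul_eq_div, ← sub_div, abs_div, abs_of_pos hn, div_le_iff₀ hn]
  calc |Real.log G.numEulerianOrientations - ∑ v, localEntropy G.graph x K v|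
    _ ≤ G.graph.edgeFinset.card * (-Real.log x + x ^ (K + 1) / (1 - x)) :=
      FinGraph.abs_log_sub_sum_localEntropy_le hG hx0 hx1 K
    _ ≤ (Δ + 1) * G.order * (ε / (Δ + 1)) := by grw [hK, hedges]
    _ = ε * G.order := by field_simp

end Neighbourhoods

section BoundedDegree

namespace FinGraph

variable {G : FinGraph.{u}} {Δ : ℕ}

theorem ballSet_zero (v : G.V) : G.ballSet v 0 = {v} := by
  ext w
  simp [ballSet, eq_comm (a := v)]

theorem ballSet_succ_subset (v : G.V) (r : ℕ) :
    G.ballSet v (r + 1) ⊆ insert v (⋃ a ∈ G.graph.neighborSet v, G.ballSet a r) := by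
  intro w hw
  have hw' : G.graph.edist v w ≤ (r + 1 : ℕ) := hw
  obtain ⟨p, hp⟩ := SimpleGraph.exists_walk_of_edist_ne_top
    (ne_top_of_le_ne_top (ENat.natCast_ne_top (r + 1)) hw')
  rw [← hp, Nat.cast_le] at hw'
  cases p with
  | nil => exact Set.mem_insert _ _
  | @cons _ a _ hva q =>
    have hq : q.length ≤ r := Nat.le_of_succ_le_succ hw'
    exact Or.inr (Set.mem_biUnion hva (q.edist_le.trans (Nat.cast_le.2 hq)))

theorem ncard_ballSet_le (hΔ : G.MaxDegLE Δ) (v : G.V) (r : ℕ) :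
    (G.ballSet v r).ncard ≤ ∑ i ∈ Finset.range (r + 1), Δ ^ i := by
  classical
  induction r generalizing v with
  | zero => simp [ballSet_zero]
  | succ r ih =>
    have hunion : (⋃ a ∈ G.graph.neighborFinset v, G.ballSet a r).ncard ≤
        Δ * ∑ i ∈ Finset.range (r + 1), Δ ^ i := by
      refine (Finset.set_ncard_biUnion_le _ _).trans ?_
      refine (Finset.sum_le_card_nsmul _ _ _ fun a _ => ih a).trans ?_
      rw [smul_eq_mul, SimpleGraph.card_neighborFinset_eq_degree, ← deg_eq_degree]
      exact Nat.mul_le_mul_right _ (hΔ v)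
    rw [geom_sum_succ]
    refine (Set.ncard_le_ncard (ballSet_succ_subset v r) (Set.toFinite _)).trans ?_
    refine (Set.ncard_insert_le _ _).trans (Nat.succ_le_succ ?_)
    simpa only [SimpleGraph.mem_neighborFinset, SimpleGraph.mem_neighborSet] using hunion

end FinGraph

/-- The neighbourhoods that occur in graphs of maximum degree at most `Δ`. -/
def boundedNeighbourhoods (Δ r : ℕ) : Set (Neighbourhood.{u} r) :=
  {q | ∃ G : FinGraph.{u}, G.MaxDegLE Δ ∧ ∃ v, G.neighbourhood r v = q}

theorem finite_boundedNeighbourhoods (Δ r : ℕ) : (boundedNeighbourhoods.{u} Δ r).Finite := by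
  let B := ∑ i ∈ Finset.range (r + 1), Δ ^ i
  let X := Σ n : Fin (B + 1), SimpleGraph (Fin n) × Fin n
  have hmodel (q : boundedNeighbourhoods.{u} Δ r) : ∃ x : X,
      ∃ A : {A : RootedGraph.{u} // A.RadiusLE r}, ⟦A⟧ = q.1 ∧
        ∃ e : A.1.graph ≃g x.2.1, e A.1.root = x.2.2 := by
    obtain ⟨q, G, hΔ, v, rfl⟩ := q
    let e := Finite.equivFin (G.ballSet v r)
    refine ⟨⟨⟨Nat.card (G.ballSet v r), Nat.lt_succ_of_le (FinGraph.ncard_ballSet_le hΔ v r)⟩,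
      (G.ball v r).graph.map e.toEmbedding, e (G.ball v r).root⟩,
      ⟨G.ball v r, G.ball_radiusLE v r⟩, rfl, SimpleGraph.Iso.map e _, rfl⟩
  choose model hmodel using hmodel
  refine Finite.of_injective model fun q q' hqq' => Subtype.ext ?_
  obtain ⟨A, hA, e, he⟩ := hmodel q
  obtain ⟨A', hA', e', he'⟩ := hqq' ▸ hmodel q'
  rw [← hA, ← hA']
  refine Quotient.sound ⟨e.trans e'.symm, ?_⟩
  exact e'.symm_apply_eq.2 (he.trans he'.symm)

theorem exists_forall_abs_neighbourhood_le (Δ : ℕ) {r : ℕ} (ψ : Neighbourhood.{u} r → ℝ) :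
    ∃ M : ℝ, ∀ G : FinGraph.{u}, G.MaxDegLE Δ → ∀ v, |ψ (G.neighbourhood r v)| ≤ M := by
  obtain ⟨M, hM⟩ := ((finite_boundedNeighbourhoods.{u} Δ r).image fun q => |ψ q|).bddAbove
  exact ⟨M, fun G hG v => hM ⟨_, ⟨G, hG, v, rfl⟩, rfl⟩⟩

theorem FinGraph.average_eq_sum_ballProb {G : FinGraph.{u}} {Δ r : ℕ} (hΔ : G.MaxDegLE Δ)
    (ψ : Neighbourhood.{u} r → ℝ) :
    (∑ v, ψ (G.neighbourhood r v)) / G.order =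
      ∑ q ∈ (finite_boundedNeighbourhoods.{u} Δ r).toFinset, ψ q * G.ballProb q.out.1 r := by
  classical
  rw [← Finset.sum_fiberwise_of_maps_to (g := fun v => G.neighbourhood r v)
    (t := (finite_boundedNeighbourhoods.{u} Δ r).toFinset)
    (fun v _ => (Set.Finite.mem_toFinset _).2 ⟨G, hΔ, v, rfl⟩), Finset.sum_div]
  refine Finset.sum_congr rfl fun q _ => ?_
  have hfiber : {v | (G.ball v r).IsIso q.out.1} =
      ((Finset.univ.filter fun v => G.neighbourhood r v = q : Finset G.V) : Set G.V) := by
    ext v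
    let A : {A : RootedGraph.{u} // A.RadiusLE r} := ⟨G.ball v r, G.ball_radiusLE v r⟩
    rw [Finset.coe_filter_univ]
    exact (Quotient.mk_eq_iff_out (x := A)).symm
  rw [Finset.sum_congr rfl fun v hv => congrArg ψ (Finset.mem_filter.1 hv).2, Finset.sum_const,
    nsmul_eq_mul, FinGraph.ballProb, hfiber, Set.ncard_coe_finset, mul_comm, mul_div_assoc]

end BoundedDegree

section Sampling

theorem sum_sq_sum_sample_mul_card {V R : Type*} [Fintype V] [CommRing R] {Y : V → R}
    (hY : ∑ v, Y v = 0) (k : ℕ) :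
    (∑ x : Fin k → V, (∑ i, Y (x i)) ^ 2) * Fintype.card V =
      k * (Fintype.card V : R) ^ k * ∑ v, Y v ^ 2 := by
  induction k with
  | zero => simp
  | succ k ih =>
    have hsucc : ∑ x : Fin (k + 1) → V, (∑ i, Y (x i)) ^ 2 =
        (Fintype.card V : R) ^ k * ∑ v, Y v ^ 2 +
          Fintype.card V * ∑ x : Fin k → V, (∑ i, Y (x i)) ^ 2 := by
      rw [← (Fin.consEquiv fun _ : Fin (k + 1) => V).sum_comp, Fintype.sum_prod_type]
      simp only [Fin.consEquiv_apply, Fin.sum_univ_succ, Fin.cons_zero, Fin.cons_succ, add_sq,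
        Finset.sum_add_distrib, Finset.sum_const, Finset.card_univ, nsmul_eq_mul, Fintype.card_fun,
        Fintype.card_fin, Nat.cast_pow, ← Finset.mul_sum, ← Finset.sum_mul, hY]
      ring
    rw [hsucc, Nat.cast_succ]
    linear_combination (Fintype.card V : R) * ih

theorem ncard_lt_abs_mul_sq_le_sum_sq {α : Type*} [Fintype α] (T : α → ℝ) {c : ℝ} (hc : 0 ≤ c) :
    ({x | c < |T x|}.ncard : ℝ) * c ^ 2 ≤ ∑ x, T x ^ 2 := by
  classical
  rw [Set.ncard_eq_toFinset_card', ← nsmul_eq_mul]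
  refine (Finset.card_nsmul_le_sum _ _ _ fun x hx => ?_).trans
    (Finset.sum_le_univ_sum_of_nonneg fun x => sq_nonneg (T x))
  rw [← sq_abs (T x)]
  exact pow_le_pow_left₀ hc (Set.mem_toFinset.1 hx).le 2

variable {V : Type*} [Fintype V] [Nonempty V] {h : V → ℝ} {M : ℝ}

theorem abs_sum_div_card_le (hM : ∀ v, |h v| ≤ M) : |(∑ v, h v) / Fintype.card V| ≤ M := by
  rw [abs_div, Nat.abs_cast, div_le_iff₀ (Nat.cast_pos.2 Fintype.card_pos)]
  refine (Finset.abs_sum_le_sum_abs _ _).trans ?_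
  exact (Finset.sum_le_card_nsmul _ _ _ fun v _ => hM v).trans_eq (by simp [mul_comm])

theorem proportion_sample_deviation_le (hM : ∀ v, |h v| ≤ M) {ε : ℝ} (hε : 0 < ε) {k : ℕ}
    (hk : 0 < k) :
    ({x : Fin k → V | ε < |(∑ i, h (x i)) / k - (∑ v, h v) / Fintype.card V|}.ncard : ℝ) /
      Nat.card (Fin k → V) ≤ (2 * M) ^ 2 / (k * ε ^ 2) := by
  set n : ℝ := (Fintype.card V : ℝ) with hn_def
  set μ : ℝ := (∑ v, h v) / n with hμ_def
  have hn : 0 < n := Nat.cast_pos.2 Fintype.card_pos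
  have hk' : (0 : ℝ) < k := Nat.cast_pos.2 hk
  have hcentred : ∑ v, (h v - μ) = 0 := by
    rw [Finset.sum_sub_distrib, Finset.sum_const, Finset.card_univ, nsmul_eq_mul, hμ_def,
      mul_div_cancel₀ _ hn.ne', sub_self]
  have hvariance : ∑ v, (h v - μ) ^ 2 ≤ n * (2 * M) ^ 2 := by
    refine (Finset.sum_le_card_nsmul _ _ ((2 * M) ^ 2) fun v _ => ?_).trans_eq (by simp [n])
    have hv := (abs_sub (h v) μ).trans (add_le_add (hM v) (abs_sum_div_card_le hM))
    exact sq_le_sq' (by linarith [(abs_le.1 hv).1]) (by linarith [(abs_le.1 hv).2])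
  have hset : {x : Fin k → V | ε < |(∑ i, h (x i)) / k - μ|} =
      {x | k * ε < |∑ i, (h (x i) - μ)|} := by
    ext x
    have : (∑ i, h (x i)) / k - μ = (∑ i, (h (x i) - μ)) / k := by
      simp [sub_div, hk'.ne']
    rw [Set.mem_ofPred_eq, Set.mem_ofPred_eq, this, abs_div, Nat.abs_cast, lt_div_iff₀' hk']
  have hchebyshev := ncard_lt_abs_mul_sq_le_sum_sq (fun x : Fin k → V => ∑ i, (h (x i) - μ))
    (c := k * ε) (by positivity)
  have hsecond := sum_sq_sum_sample_mul_card hcentred k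
  rw [hset, Nat.card_fun, Nat.card_eq_fintype_card, Nat.card_fin, Nat.cast_pow,
    div_le_div_iff₀ (by positivity) (by positivity), ← hn_def]
  refine le_of_mul_le_mul_right ?_ (mul_pos hk' hn)
  calc _ = {x : Fin k → V | k * ε < |∑ i, (h (x i) - μ)|}.ncard * (k * ε) ^ 2 * n := by ring
    _ ≤ (∑ x : Fin k → V, (∑ i, (h (x i) - μ)) ^ 2) * n := by gcongr
    _ = k * n ^ k * ∑ v, (h v - μ) ^ 2 := hsecond
    _ ≤ k * n ^ k * (n * (2 * M) ^ 2) := by gcongr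
    _ = (2 * M) ^ 2 * n ^ k * (k * n) := by ring

end Sampling

section Estimability

variable {C : Set FinGraph.{u}} {f : FinGraph.{u} → ℝ} {Δ : ℕ}

theorem IsLocallyApproximableOn.exists_forall_abs_le (hf : IsLocallyApproximableOn C f)
    (hC : ∀ G ∈ C, G.MaxDegLE Δ) : ∃ M : ℝ, ∀ G ∈ C, |f G| ≤ M := by
  obtain ⟨r, -, ψ, happrox⟩ := hf 1 one_pos
  obtain ⟨M, hM⟩ := exists_forall_abs_neighbourhood_le Δ ψ
  refine ⟨1 + M, fun G hG => ?_⟩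
  have haverage := abs_sum_div_card_le (hM G (hC G hG))
  rw [← G.order_eq_card] at haverage
  simpa using (abs_add_le _ _).trans (add_le_add (happrox G hG) haverage)

theorem IsLocallyApproximableOn.isEstimableOn (hf : IsLocallyApproximableOn C f)
    (hC : ∀ G ∈ C, G.MaxDegLE Δ) : IsEstimableOn C f := by
  refine ⟨hf.exists_forall_abs_le hC, fun ε hε => ?_⟩
  obtain ⟨r, hr, ψ, happrox⟩ := hf (ε / 2) (half_pos hε)
  obtain ⟨M, hM⟩ := exists_forall_abs_neighbourhood_le Δ ψ
  obtain ⟨k, hk⟩ := exists_nat_gt ((2 * M) ^ 2 / ((ε / 2) ^ 2 * ε))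
  have hk0 : (0 : ℝ) < k := lt_of_le_of_lt (by positivity) hk
  refine ⟨k, r, Nat.cast_pos.1 hk0, hr, fun q => (∑ i, ψ (q i)) / k, fun G hG => ?_⟩
  have hsample := proportion_sample_deviation_le (hM G (hC G hG)) (half_pos hε)
    (Nat.cast_pos.1 hk0)
  rw [← G.order_eq_card] at hsample
  have hsubset : {x : Fin k → G.V | ε < |f G - (∑ i, ψ (G.neighbourhood r (x i))) / k|} ⊆
      {x | ε / 2 < |(∑ i, ψ (G.neighbourhood r (x i))) / k -
        (∑ v, ψ (G.neighbourhood r v)) / G.order|} := by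
    intro x hx
    have hx' : ε < |f G - (∑ i, ψ (G.neighbourhood r (x i))) / k| := hx
    have htriangle := abs_sub_le (f G) ((∑ v, ψ (G.neighbourhood r v)) / G.order)
      ((∑ i, ψ (G.neighbourhood r (x i))) / k)
    rw [abs_sub_comm ((∑ v, ψ (G.neighbourhood r v)) / (G.order : ℝ))] at htriangle
    change ε / 2 < _
    linarith [happrox G hG]
  refine ((div_le_div_of_nonneg_right (Nat.cast_le.2
    (Set.ncard_le_ncard hsubset (Set.toFinite _))) (Nat.cast_nonneg _)).trans hsample).trans ?_
  rw [div_lt_iff₀ (by positivity)] at hk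
  rw [div_le_iff₀ (by positivity)]
  linarith

theorem cauchySeq_of_forall_exists_dist_le {α : Type*} [PseudoMetricSpace α] {a : ℕ → α}
    (h : ∀ ε > 0, ∃ b : ℕ → α, CauchySeq b ∧ ∀ n, dist (a n) (b n) ≤ ε) : CauchySeq a := by
  refine Metric.cauchySeq_iff'.2 fun ε hε => ?_
  obtain ⟨b, hb, hab⟩ := h (ε / 3) (by positivity)
  obtain ⟨N, hN⟩ := Metric.cauchySeq_iff'.1 hb (ε / 3) (by positivity)
  refine ⟨N, fun n hn => ?_⟩
  have htriangle := dist_triangle4 (a n) (b n) (b N) (a N)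
  rw [dist_comm (b N)] at htriangle
  linarith [hab n, hab N, hN n hn]

theorem BSConvergent.exists_tendsto_average {G : ℕ → FinGraph.{u}} (hG : BSConvergent G) {r : ℕ}
    (hr : 0 < r) (ψ : Neighbourhood.{u} r → ℝ) :
    ∃ l : ℝ, Tendsto (fun n => (∑ v, ψ ((G n).neighbourhood r v)) / (G n).order) atTop (𝓝 l) := by
  obtain ⟨⟨Δ, hΔ⟩, hprob⟩ := hG
  choose p hp using fun q : Neighbourhood.{u} r => hprob q.out.1 r hr
  simp only [fun n => FinGraph.average_eq_sum_ballProb (hΔ n) ψ]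
  exact ⟨_, tendsto_finsetSum _ fun q _ => (hp q).const_mul (ψ q)⟩

theorem IsLocallyApproximableOn.exists_tendsto (hf : IsLocallyApproximableOn C f)
    {G : ℕ → FinGraph.{u}} (hG : BSConvergent G) (hGC : ∀ n, G n ∈ C) :
    ∃ l : ℝ, Tendsto (fun n => f (G n)) atTop (𝓝 l) := by
  refine cauchySeq_tendsto_of_complete (cauchySeq_of_forall_exists_dist_le fun ε hε => ?_)
  obtain ⟨r, hr, ψ, happrox⟩ := hf ε hε
  obtain ⟨l, hl⟩ := hG.exists_tendsto_average hr ψ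
  exact ⟨_, hl.cauchySeq, fun n => happrox (G n) (hGC n)⟩

end Estimability

end EulerOr

theorem theorem2 :
    -- every Eulerian graph has an Eulerian orientation, so that the logarithm makes sense
    (∀ G : EulerOr.FinGraph.{u}, G.IsEulerian → 0 < G.numEulerianOrientations) ∧
    -- convergence along Benjamini–Schramm convergent sequences of Eulerian graphs
    (∀ G : ℕ → EulerOr.FinGraph.{u}, EulerOr.BSConvergent G → (∀ n, (G n).IsEulerian) →
      ∃ l : ℝ, Tendsto
        (fun n => 1 / ((G n).order : ℝ) * Real.log ((G n).numEulerianOrientations : ℝ))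
        atTop (𝓝 l)) ∧
    -- estimability on Eulerian graphs of bounded degree
    (∀ Δ : ℕ, EulerOr.IsEstimableOn
      {G : EulerOr.FinGraph.{u} | G.IsEulerian ∧ G.MaxDegLE Δ} EulerOr.FinGraph.entropy) := by
  have happrox := EulerOr.isLocallyApproximableOn_entropy.{u}
  refine ⟨fun G hG => EulerOr.FinGraph.numEulerianOrientations_pos hG, fun G hconv hG => ?_,
    fun Δ => (happrox Δ).isEstimableOn fun G hG => hG.2⟩
  obtain ⟨Δ, hΔ⟩ := hconv.1
  exact (happrox Δ).exists_tendsto hconv fun n => ⟨hG n, hΔ n⟩
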